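/- **Setting.** Let $N\ge 0$ and $M=\lfloor N/2\rfloor$. Index the standard basis $e_i$ of $\mathbb C^N$ by $i\in\{-M,\dots,-1,1,\dots,M\}$ if $N=2M$, and by $i\in\{-M,\dots,M\}$ if $N=2M+1$. Let $\mathfrak g\subset\mathfrak{gl}_N$ be either $\mathfrak{so}_N$, the Lie algebra of the orthogonal group of the form $\langle e_i,e_j\rangle=\delta_{i,-j}$, or, for $N=2M$, $\mathfrak{sp}_N$, the Lie algebra of the symplectic group of the form $\langle e_i,e_j\rangle=\delta_{i,-j}\,\mathrm{sgn}\,i$. Put $\varepsilon_{ij}=1$, $\eta=\frac12$ for $\mathfrak{so}_N$ and $\varepsilon_{ij}=\mathrm{sgn}\,i\cdot\mathrm{sgn}\,j$, $\eta=-\frac12$ for $\mathfrak{sp}_N$. With the matrix units $E_{ij}$, the Lie algebra $\mathfrak g$ is spanned by $F_{ij}=E_{ij}-\varepsilon_{ij}E_{-j,-i}$. Put $$F(v)=-v-\eta+\sum_{i,j}E_{ij}\otimes F_{ji},\qquad Q=\sum_{i,j}\varepsilon_{ij}\,E_{ij}\otimes E_{-i,-j}.$$ In $\mathrm{End}(\mathbb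 C^N)^{\otimes n}\otimes \mathrm U(\mathfrak g)$ let $F_p(v)$ and $Q_{qp}$ be the copies of $F(v)$ and $Q$ in the tensor factors $p$ and $q,p$ respectively. Let $m\ge 0$, $n=2m$, let $\nu$ be a partition of $n$ with at most $N$ parts and $T$ a standard tableau of shape $\nu$. Let $c_p$ be the content (column number minus row number) of the box of $T$ occupied by $p$. Let $W_\nu$ be the irreducible $S_n$-module corresponding to $\nu$, with an $S_n$-invariant inner product, and let $w_T\in W_\nu$ be a unit vector such that for each $p=1,\dots,n$ the vector $w_T$ lies in an irreducible $S_p$-submodule corresponding to the shape of the tableau obtained from $T$ by removing $p+1,\dots,n$. Put $$\Phi_T=\frac{\dim W_\nu}{n!}\sum_{\sigma\in S_n}\langle w_T,\sigma w_T\rangle\,\sigma\in\mathbb C\cdot S_n ,$$ and let $Y_T$ be the operator by which $\Phi_T$ acts in $(\mathbb C^N)^{\otimes n}$ by permuting the tensor factors. In all products below the factors are arranged from left to right as $p$ increases. Put $$Z_\nu(u)=(\mathrm{tr}^{\otimes n}\otimes\mathrm{id})\Bigl((Y_T\otimes1)\prod_{p=1}^n\Bigl(1+\frac{Q_{1p}+\dots+Q_{p-1,p}}{2u+c_p}\Bigr)F_p(u+c_p)\Bigr)\in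 \mathrm U(\mathfrak g)\otimes\mathbb C(u).$$ This element has degree at most $n$ in the standard filtration of $\mathrm U(\mathfrak g)$. Its class in $(\mathrm U_n(\mathfrak g)/\mathrm U_{n-1}(\mathfrak g))\otimes\mathbb C(u)$, regarded as an element of $\mathrm S^n(\mathfrak g)\otimes\mathbb C(u)$, has an image $$f_\nu(x_1,\dots,x_M\,|\,u)\in\mathbb C[x_1,\dots,x_M]\otimes\mathbb C(u)$$ under the algebra homomorphism $\mathrm S(\mathfrak g)\to\mathbb C[x_1,\dots,x_M]$ with $F_{ij}\mapsto0$ if $i\ne j$ or $i=j=0$, and $F_{-M,-M}\mapsto x_1,\dots,F_{-1,-1}\mapsto x_M$. Let $H_n\subset S_{2n}$ be the centralizer of $(1,n+1)\cdots(n,2n)$. Let $\chi_\pm$ be the characters of $H_n$ which are trivial on the simultaneous permutations of $1,\dots,n$ and of $n+1,\dots,2n$, and satisfy $\chi_\pm((s,n+s))=\pm1$. Put $h_\pm=\frac1{n!\,2^n}\sum_{\sigma\in H_n}\chi_\pm(\sigma)\sigma$. Regard $S_n$ as the subgroup of $S_{2n}$ fixing $n+1,\dots,2n$, and put $$\Psi_T(u)=\prod_{p=1}^n\Bigl(1+\frac{(1,n+p)+\dots+(p-1,n+p)}{2u+c_p}\Bigr)\cdot\Phi_T\in\mathbb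 C(u)\cdot S_{2n}.$$ Let $\Lambda_M$ be the ring of symmetric polynomials in $x_1,\dots,x_M$ over $\mathbb C$. For a partition $\rho$ with $\ell(\rho)$ parts put $p_\rho(x_1,\dots,x_M)=\prod_{k=1}^{\ell(\rho)}(x_1^{\rho_k}+\dots+x_M^{\rho_k})$. **Proposition 3.2.** There are unique linear maps $$\mathrm{ch}:h_-(\mathbb C\cdot S_{2n})h_+\to\Lambda_M\qquad\text{and}\qquad\mathrm{ch}:h_+(\mathbb C\cdot S_{2n})h_-\to\Lambda_M$$ such that $\mathrm{ch}(h_\mp\sigma h_\pm)=2^{\ell(\rho)}p_\rho(x_1^2,\dots,x_M^2)$ for every partition $\rho$ of $m$ and every $\sigma\in S_n$ with the cycle lengths $2\rho_1,2\rho_2,\dots$ (the characteristic maps). Extend them linearly over $\mathbb C(u)$. Then $$f_\nu(x_1,\dots,x_M\,|\,u)=\mathrm{ch}\bigl(h_-\Psi_T(u)h_+\bigr)\ \text{ for }\mathfrak g=\mathfrak{so}_N,\qquad f_\nu(x_1,\dots,x_M\,|\,u)=\mathrm{ch}\bigl(h_+\Psi_T(u)h_-\bigr)\ \text{ for }\mathfrak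 g=\mathfrak{sp}_N,$$ where $f_\nu$ is computed from the same tableau $T$. -/

import Mathlib

open scoped TensorProduct

noncomputable section

namespace Capelli

attribute [local instance 100] LieRing.ofAssociativeRing

/-! ### The field of rational functions in the parameter `u` -/

/-- The field `ℂ(u)`; the parameter `u` is `RatFunc.X`. -/
abbrev Cu : Type := RatFunc ℂ

/-! ### The classical Lie algebras -/

/-- The two families of classical Lie algebras: `so N` stands for `so_N`, and `sp M` for
`sp_{2M}`. -/
inductive ClassicalType : Type
  | so (N : ℕ)
  | sp (M : ℕ)

namespace ClassicalType

/-- The dimension `N` of the defining representation. -/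
def size : ClassicalType → ℕ
  | so N => N
  | sp M => 2 * M

/-- The rank `M = ⌊N / 2⌋`. -/
def rank : ClassicalType → ℕ
  | so N => N / 2
  | sp M => M

/-- The index set of the standard basis of `ℂ^N`: `{-M, …, -1, 1, …, M}` if `N = 2M`, and
`{-M, …, -1, 0, 1, …, M}` if `N = 2M + 1`. -/
def idxFinset (t : ClassicalType) : Finset ℤ :=
  (Finset.Icc (-(t.rank : ℤ)) (t.rank : ℤ)).filter (fun i => i = 0 → Odd t.size)

/-- The index set as a type. -/
abbrev Idx (t : ClassicalType) : Type := {i : ℤ // i ∈ t.idxFinset}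

lemma neg_mem_idxFinset {t : ClassicalType} {i : ℤ} (h : i ∈ t.idxFinset) :
    -i ∈ t.idxFinset := by
  simp only [idxFinset, Finset.mem_filter, Finset.mem_Icc] at h ⊢
  refine ⟨⟨by omega, by omega⟩, fun h0 => h.2 (by omega)⟩

instance (t : ClassicalType) : Neg t.Idx := ⟨fun i => ⟨-i.1, neg_mem_idxFinset i.2⟩⟩

lemma Idx.coe_neg {t : ClassicalType} (i : t.Idx) : ((-i : t.Idx) : ℤ) = -(i : ℤ) := rfl

lemma Idx.neg_neg {t : ClassicalType} (i : t.Idx) : -(-i) = i :=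
  Subtype.ext (by rw [Idx.coe_neg, Idx.coe_neg, _root_.neg_neg])

/-- The sign `ε_i`: it is `1` for `so_N` and `sgn i` for `sp_N`. -/
def eps : (t : ClassicalType) → t.Idx → ℂ
  | so _, _ => 1
  | sp _, i => ((Int.sign (i : ℤ) : ℤ) : ℂ)

/-- The Gram matrix of the bilinear form on `ℂ^N`: `⟨e_i, e_j⟩ = δ_{i,-j} ε_i`. -/
def form (t : ClassicalType) : Matrix t.Idx t.Idx ℂ :=
  Matrix.of fun i j => if i = -j then t.eps i else 0

/-- The Lie algebra `𝔤 ⊆ gl_N` of the group preserving the bilinear form: the matrices `A`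
with `⟨A v, w⟩ = -⟨v, A w⟩`. -/
abbrev lieAlg (t : ClassicalType) : LieSubalgebra ℂ (Matrix t.Idx t.Idx ℂ) :=
  skewAdjointMatricesLieSubalgebra t.form

/-- The matrix `E_{ij} - ε_i ε_j E_{-j,-i}`. -/
def Fmat (t : ClassicalType) (i j : t.Idx) : Matrix t.Idx t.Idx ℂ :=
  Matrix.single i j 1 - (t.eps i * t.eps j) • Matrix.single (-j) (-i) 1

lemma Idx.ne_zero_of_sp {M : ℕ} (i : (sp M).Idx) : (i : ℤ) ≠ 0 := by
  intro h
  exact (Nat.not_odd_iff_even.2 (even_two_mul M)) ((Finset.mem_filter.1 i.2).2 h)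

lemma eps_mul_self (t : ClassicalType) (i : t.Idx) : t.eps i * t.eps i = 1 := by
  cases t with
  | so N => simp [eps]
  | sp M =>
    rcases lt_or_gt_of_ne (Idx.ne_zero_of_sp i) with h | h
    · simp [eps, Int.sign_eq_neg_one_of_neg h]
    · simp [eps, Int.sign_eq_one_of_pos h]

/-- `ε_i ε_{-i}` does not depend on `i`. -/
lemma eps_mul_eps_neg (t : ClassicalType) (i j : t.Idx) :
    t.eps i * t.eps (-i) = t.eps j * t.eps (-j) := by
  cases t with
  | so N => simp [eps]
  | sp M =>
    have key : ∀ k : (sp M).Idx, (sp M).eps k * (sp M).eps (-k) = -1 := by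
      intro k
      have h := eps_mul_self (sp M) k
      have h2 : (sp M).eps (-k) = -(sp M).eps k := by
        simp [eps, Idx.coe_neg, Int.sign_neg]
      rw [h2, mul_neg, h]
    rw [key i, key j]

lemma Fmat_mem (t : ClassicalType) (i j : t.Idx) : t.Fmat i j ∈ t.lieAlg := by
  rw [mem_skewAdjointMatricesLieSubalgebra, mem_skewAdjointMatricesSubmodule]
  have neg_inj' : ∀ a b : t.Idx, -a = b ↔ a = -b := fun a b =>
    ⟨fun h => by rw [← h, Idx.neg_neg], fun h => by rw [h, Idx.neg_neg]⟩
  have h1 : ∀ a b : t.Idx, Matrix.transpose (Matrix.single a b (1 : ℂ)) * t.form =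
      t.eps a • Matrix.single b (-a) 1 := by
    intro a b
    ext x y
    rw [Matrix.transpose_single, Matrix.mul_apply]
    simp only [Matrix.single_apply, form, Matrix.of_apply, Matrix.smul_apply, smul_eq_mul]
    rw [Finset.sum_eq_single a]
    · by_cases hx : b = x <;> by_cases hy : a = -y <;> simp [hx, hy, neg_inj']
    · intro c _ hc
      simp [hc.symm]
    · simp
  have h2 : ∀ a b : t.Idx, t.form * Matrix.single a b (1 : ℂ) =
      t.eps (-a) • Matrix.single (-a) b 1 := by
    intro a b
    ext x y
    rw [Matrix.mul_apply]
    simp only [Matrix.single_apply, form, Matrix.of_apply, Matrix.smul_apply, smul_eq_mul]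
    rw [Finset.sum_eq_single a]
    · by_cases hx : x = -a <;> by_cases hy : b = y <;> simp [hx, hy, eq_comm]
    · intro c _ hc
      simp [hc.symm]
    · simp
  rw [Matrix.IsSkewAdjoint, Matrix.IsAdjointPair, Fmat, Matrix.transpose_sub, sub_mul,
    Matrix.transpose_smul, Matrix.smul_mul, h1, h1, mul_neg, mul_sub, Matrix.mul_smul, h2, h2,
    smul_smul, smul_smul]
  have e1 : t.eps i * t.eps j * t.eps (-j) = t.eps (-i) := by
    rw [mul_assoc, eps_mul_eps_neg t j i, ← mul_assoc, eps_mul_self, one_mul]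
  have e2 : t.eps i * t.eps j * t.eps j = t.eps i := by
    rw [mul_assoc, eps_mul_self, mul_one]
  rw [Idx.neg_neg, e1, e2]
  abel

/-- The generator `F_{ij}` of `𝔤`. -/
def F (t : ClassicalType) (i j : t.Idx) : t.lieAlg := ⟨t.Fmat i j, t.Fmat_mem i j⟩

/-- The constant `η`: it is `1/2` for `so_N` and `-1/2` for `sp_N`. -/
def eta : ClassicalType → ℂ
  | so _ => 1 / 2
  | sp _ => -(1 / 2)

/-- The index `-M + k`, for `k = 0, …, M - 1`. -/
def negIdx (t : ClassicalType) (k : Fin t.rank) : t.Idx :=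
  ⟨(k : ℤ) - t.rank, by
    have := k.2
    simp only [idxFinset, Finset.mem_filter, Finset.mem_Icc]
    refine ⟨⟨by omega, by omega⟩, fun h0 => by omega⟩⟩

/-- The linear map `𝔤 → ℂ[x_1, …, x_M]` with `F_{ij} ↦ 0` if `i ≠ j` or `i = j = 0`, and with
`F_{-M,-M} ↦ x_1, …, F_{-1,-1} ↦ x_M` (see `cartanProj_F_of_ne`, `cartanProj_F_zero` and
`cartanProj_F_negIdx`).  The variable `x_{k+1}` is `MvPolynomial.X k`. -/
def cartanProj (t : ClassicalType) : t.lieAlg →ₗ[ℂ] MvPolynomial (Fin t.rank) ℂ where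
  toFun A := ∑ k : Fin t.rank, (A : Matrix t.Idx t.Idx ℂ) (t.negIdx k) (t.negIdx k) •
    MvPolynomial.X k
  map_add' A B := by simp [add_smul, Finset.sum_add_distrib]
  map_smul' c A := by simp [mul_smul, Finset.smul_sum]

lemma cartanProj_F_of_ne (t : ClassicalType) {i j : t.Idx} (h : i ≠ j) :
    t.cartanProj (t.F i j) = 0 := by
  change ∑ l : Fin t.rank, _ = _
  refine Finset.sum_eq_zero fun k _ => ?_
  have h1 : ¬ (i = t.negIdx k ∧ j = t.negIdx k) := fun h' => h (h'.1.trans h'.2.symm)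
  have h2 : ¬ (-j = t.negIdx k ∧ -i = t.negIdx k) := fun h' => h (by
    rw [← Idx.neg_neg i, ← Idx.neg_neg j, h'.1, h'.2])
  simp [F, Fmat, h1, h2]

lemma cartanProj_F_zero (t : ClassicalType) {i : t.Idx} (h : (i : ℤ) = 0) :
    t.cartanProj (t.F i i) = 0 := by
  have h' : -i = i := Subtype.ext (by rw [Idx.coe_neg, h, neg_zero])
  change ∑ l : Fin t.rank, _ = _
  refine Finset.sum_eq_zero fun k _ => ?_
  simp [F, Fmat, h', eps_mul_self]

lemma cartanProj_F_negIdx (t : ClassicalType) (k : Fin t.rank) :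
    t.cartanProj (t.F (t.negIdx k) (t.negIdx k)) = MvPolynomial.X k := by
  have hinj : ∀ a b : Fin t.rank, t.negIdx a = t.negIdx b ↔ a = b := by
    intro a b
    refine ⟨fun h => ?_, fun h => by rw [h]⟩
    have h' := congrArg Subtype.val h
    simp only [negIdx] at h'
    exact Fin.ext (by omega)
  have hne : ∀ a b : Fin t.rank, -(t.negIdx a) ≠ t.negIdx b := by
    intro a b h
    have h' := congrArg Subtype.val h
    rw [Idx.coe_neg] at h'
    simp only [negIdx] at h'
    have := a.2
    have := b.2
    omega
  change ∑ l : Fin t.rank, _ = _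
  rw [Finset.sum_eq_single k]
  · simp [F, Fmat, hne]
  · intro l _ hl
    have : ¬ (t.negIdx k = t.negIdx l) := fun h => hl ((hinj _ _).1 h).symm
    simp [F, Fmat, hne, this]
  · simp

/-! ### Enveloping algebra, symmetric algebra and leading terms -/

/-- The universal enveloping algebra `U(𝔤)`. -/
abbrev U (t : ClassicalType) : Type := UniversalEnvelopingAlgebra ℂ t.lieAlg

/-- The symmetric algebra `S(𝔤)`. -/
abbrev S (t : ClassicalType) : Type := SymmetricAlgebra ℂ t.lieAlg

/-- The subspace `T^n(𝔤)` of the tensor algebra. -/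
def tensorPow (t : ClassicalType) (n : ℕ) : Submodule ℂ (TensorAlgebra ℂ t.lieAlg) :=
  (LinearMap.range (TensorAlgebra.ι ℂ : t.lieAlg →ₗ[ℂ] TensorAlgebra ℂ t.lieAlg)) ^ n

/-- The subspace of `U(𝔤)` of elements of degree less than `n` in the standard filtration: it is
spanned by the products of less than `n` elements of `𝔤`.  So it is `U_{n-1}(𝔤)` for `n ≥ 1`, and
zero for `n = 0`. -/
def filtLT (t : ClassicalType) (n : ℕ) : Submodule ℂ t.U :=
  ⨆ k ∈ Finset.range n,
    (LinearMap.range (UniversalEnvelopingAlgebra.ι ℂ : t.lieAlg →ₗ⁅ℂ⁆ t.U).toLinearMap) ^ k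

/-- `s ∈ Sⁿ(𝔤) ⊗ ℂ(u)` is the leading term in degree `n` of `Z ∈ U(𝔤) ⊗ ℂ(u)`: the element `Z` lies
in `U_n(𝔤) ⊗ ℂ(u)`, and its class modulo `U_{n-1}(𝔤) ⊗ ℂ(u)` corresponds to `s` under the canonical
map from `Sⁿ(𝔤)` to `U_n(𝔤) / U_{n-1}(𝔤)`, which takes `a_1 ⋯ a_n` to the class of the
product `a_1 ⋯ a_n` in `U(𝔤)`. -/
def IsLeadingTerm (t : ClassicalType) (n : ℕ) (Z : Cu ⊗[ℂ] t.U) (s : Cu ⊗[ℂ] t.S) : Prop :=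
  ∃ a ∈ (t.tensorPow n).baseChange Cu,
    (SymmetricAlgebra.algHom ℂ t.lieAlg).toLinearMap.baseChange Cu a = s ∧
    Z - (UniversalEnvelopingAlgebra.mkAlgHom ℂ t.lieAlg).toLinearMap.baseChange Cu a ∈
      (t.filtLT n).baseChange Cu

/-- `f ∈ ℂ[x_1, …, x_M] ⊗ ℂ(u)` is the image of the leading term of `Z` in degree `n` under the
algebra homomorphism `S(𝔤) → ℂ[x_1, …, x_M]` that extends `cartanProj`. -/
def IsLeadingPolynomial (t : ClassicalType) (n : ℕ) (Z : Cu ⊗[ℂ] t.U)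
    (f : Cu ⊗[ℂ] MvPolynomial (Fin t.rank) ℂ) : Prop :=
  ∃ s : Cu ⊗[ℂ] t.S, t.IsLeadingTerm n Z s ∧
    (SymmetricAlgebra.lift t.cartanProj).toLinearMap.baseChange Cu s = f

end ClassicalType

/-! ### Standard tableaux -/

/-- A standard tableau of shape `ν` with the entries `1, …, n`; the entry `p + 1` is `p : Fin n`.
A box `(l, k)` of a Young diagram is in row `l` and column `k`, counted from `0`. -/
structure StandardTableau (ν : YoungDiagram) (n : ℕ) where
  /-- the box occupied by a given number -/
  box : Fin n ≃ {b : ℕ × ℕ // b ∈ ν.cells}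
  /-- the numbers increase along every row -/
  row_lt : ∀ p q : Fin n, (box p).1.1 = (box q).1.1 → (box p).1.2 < (box q).1.2 → p < q
  /-- the numbers increase down every column -/
  col_lt : ∀ p q : Fin n, (box p).1.2 = (box q).1.2 → (box p).1.1 < (box q).1.1 → p < q

/-- The content `c_p` of the box occupied by `p`: column number minus row number. -/
def StandardTableau.content {ν : YoungDiagram} {n : ℕ} (T : StandardTableau ν n) (p : Fin n) : ℤ :=
  ((T.box p).1.2 : ℤ) - ((T.box p).1.1 : ℤ)

/-! ### Irreducible representations of symmetric groups and the Young basis -/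

/-- The group ring `ℂ · Sym(α)`. -/
abbrev GroupRing (α : Type) : Type := MonoidAlgebra ℂ (Equiv.Perm α)

/-- A permutation as an element of the group ring. -/
abbrev gr {α : Type} (σ : Equiv.Perm α) : GroupRing α := MonoidAlgebra.single σ 1

section Specht

variable {α : Type} [Fintype α] [DecidableEq α]

/-- The Young symmetrizer of a filling of a Young diagram by the elements of `α`, each element
being used once; `box a` is the box occupied by `a`.  It is the sum of the permutations preserving
the rows times the signed sum of the permutations preserving the columns. -/
def youngSymmetrizer (box : α → ℕ × ℕ) : GroupRing α :=
  (∑ σ : Equiv.Perm α with ∀ a, (box (σ a)).1 = (box a).1, gr σ) *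
    (∑ σ : Equiv.Perm α with ∀ a, (box (σ a)).2 = (box a).2,
      ((Equiv.Perm.sign σ : ℤ) : ℂ) • gr σ)

/-- The irreducible module of `Sym(α)` corresponding to the shape of the filling: the left ideal of
the group ring generated by the Young symmetrizer. -/
def specht (box : α → ℕ × ℕ) : Submodule (GroupRing α) (GroupRing α) :=
  Submodule.span (GroupRing α) {youngSymmetrizer box}

/-- The linear map `φ` from the irreducible module of the given shape is equivariant. -/
def IsEquivariant {W : Type*} [AddCommGroup W] [Module ℂ W] (box : α → ℕ × ℕ)
    (ρ : Representation ℂ (Equiv.Perm α) W) (φ : specht box →ₗ[ℂ] W) : Prop :=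
  ∀ (σ : Equiv.Perm α) (x : specht box), φ (gr σ • x) = ρ σ (φ x)

end Specht

/-- The restriction of a representation of `S_n` to the subgroup `S_{p+1}` of the permutations
of the numbers that do not exceed `p`. -/
def restrictRep {n : ℕ} {W : Type*} [AddCommGroup W] [Module ℂ W]
    (ρ : Representation ℂ (Equiv.Perm (Fin n)) W) (p : Fin n) :
    Representation ℂ (Equiv.Perm {q : Fin n // q ≤ p}) W :=
  ρ.comp (Equiv.Perm.ofSubtype (p := fun q : Fin n => q ≤ p))

/-- `W` with the action `ρ` and its inner product is the irreducible `S_n`-module `W_ν` with an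
invariant inner product, and `w` is the vector `w_T` of a Young basis of `W_ν`. -/
structure IsYoungVector {ν : YoungDiagram} {n : ℕ} (T : StandardTableau ν n)
    {W : Type*} [NormedAddCommGroup W] [InnerProductSpace ℂ W]
    (ρ : Representation ℂ (Equiv.Perm (Fin n)) W) (w : W) : Prop where
  /-- `W` is the irreducible `S_n`-module corresponding to `ν` -/
  irreducible : ∃ φ : specht (fun q => (T.box q).1) →ₗ[ℂ] W,
    Function.Bijective φ ∧ IsEquivariant _ ρ φ
  /-- the inner product is `S_n`-invariant -/
  invariant : ∀ (σ : Equiv.Perm (Fin n)) (v v' : W), inner ℂ (ρ σ v) (ρ σ v') = inner ℂ v v'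
  /-- for every `p`, the vector `w` belongs to an irreducible submodule over the group of
  permutations of the numbers up to `p`, corresponding to the shape of the tableau obtained
  from `T` by removing the numbers greater than `p` -/
  mem_irreducible : ∀ p : Fin n,
    ∃ φ : specht (fun q : {q : Fin n // q ≤ p} => (T.box q.1).1) →ₗ[ℂ] W,
      Function.Injective φ ∧ IsEquivariant _ (restrictRep ρ p) φ ∧ w ∈ LinearMap.range φ
  /-- `⟨w_T, w_T⟩ = 1` -/
  inner_self : inner ℂ w w = 1

/-- The normalized diagonal matrix element
`(dim W / n!) ∑_σ ⟨w, σ w⟩ σ`, which is `Φ_T` for `w = w_T`. -/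
def matrixElement {n : ℕ} {W : Type*} [NormedAddCommGroup W] [InnerProductSpace ℂ W]
    (ρ : Representation ℂ (Equiv.Perm (Fin n)) W) (w : W) : GroupRing (Fin n) :=
  ((Module.finrank ℂ W : ℂ) / (n.factorial : ℂ)) •
    ∑ σ : Equiv.Perm (Fin n), (inner ℂ w (ρ σ w)) • gr σ

/-! ### The element `F_T(u)` and its trace `Z_ν(u)` -/

section Trace

variable (t : ClassicalType) {n : ℕ}

/-- The embedding `ι_p` of `End(ℂ^N)` into `End(ℂ^N)^{⊗ n}` as the `p`-th tensor factor, with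
coefficients in a ring `R`.  The basis of `(ℂ^N)^{⊗ n}` is indexed by the functions
`a : Fin n → Idx`, which stand for `e_{a_1} ⊗ ⋯ ⊗ e_{a_n}`. -/
def iota {R : Type*} [Zero R] (p : Fin n) (X : Matrix t.Idx t.Idx R) :
    Matrix (Fin n → t.Idx) (Fin n → t.Idx) R :=
  Matrix.of fun a b => if ∀ q, q ≠ p → a q = b q then X (a p) (b p) else 0

/-- The operator `Q_{pq}`, where `Q = ∑ ε_i ε_j E_{ij} ⊗ E_{-i,-j}`. -/
def Qop (p q : Fin n) : Matrix (Fin n → t.Idx) (Fin n → t.Idx) ℂ :=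
  ∑ i : t.Idx, ∑ j : t.Idx, (t.eps i * t.eps j) •
    (iota t p (Matrix.single i j 1) * iota t q (Matrix.single (-i) (-j) 1))

/-- The operator in `(ℂ^N)^{⊗ n}` permuting the tensor factors:
`e_{b_1} ⊗ ⋯ ⊗ e_{b_n}` goes to the tensor whose factor number `σ p` is `e_{b_p}`. -/
def permOp (σ : Equiv.Perm (Fin n)) : Matrix (Fin n → t.Idx) (Fin n → t.Idx) ℂ :=
  Matrix.of fun a b => if ∀ p, a (σ p) = b p then 1 else 0

/-- The action of the group ring of `S_n` in `(ℂ^N)^{⊗ n}`. -/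
def groupRingOp (x : GroupRing (Fin n)) : Matrix (Fin n → t.Idx) (Fin n → t.Idx) ℂ :=
  ∑ σ : Equiv.Perm (Fin n), x.coeff σ • permOp t σ

/-- The algebra `U(𝔤) ⊗ ℂ(u)` of rational functions of `u` with values in `U(𝔤)`. -/
abbrev Uu : Type := Cu ⊗[ℂ] t.U

/-- The image of an operator under `X ↦ X ⊗ 1`. -/
def liftOp (A : Matrix (Fin n → t.Idx) (Fin n → t.Idx) ℂ) :
    Matrix (Fin n → t.Idx) (Fin n → t.Idx) (Uu t) :=
  A.map (algebraMap ℂ (Uu t))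

/-- `F(v) = -v - η + ∑ E_{ij} ⊗ F_{ji}` for `v ∈ ℂ(u)`, as an `N × N` matrix over
`U(𝔤) ⊗ ℂ(u)`. -/
def Fv (v : Cu) : Matrix t.Idx t.Idx (Uu t) :=
  Matrix.of fun i j =>
    (1 : Cu) ⊗ₜ[ℂ] UniversalEnvelopingAlgebra.ι ℂ (t.F j i) -
      (if i = j then (v + algebraMap ℂ Cu t.eta) ⊗ₜ[ℂ] (1 : t.U) else 0)

/-- The element `F_T(u)` of `End(ℂ^N)^{⊗ n} ⊗ U(𝔤)(u)`: the product of `Y_T ⊗ 1` and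
of the factors `(1 + (Q_{1p} + ⋯ + Q_{p-1,p}) / (2u + c_p)) F_p(u + c_p)` for `p = 1, …, n`,
arranged from the left to the right.  Here `Φ` stands for `Φ_T` and
`Y_T` is its image in `End(ℂ^N)^{⊗ n}`. -/
def FT {ν : YoungDiagram} (T : StandardTableau ν n) (Φ : GroupRing (Fin n)) :
    Matrix (Fin n → t.Idx) (Fin n → t.Idx) (Uu t) :=
  liftOp t (groupRingOp t Φ) *
    (List.ofFn fun p : Fin n =>
      (1 + ((2 * RatFunc.X + (T.content p : Cu))⁻¹ : Cu) •
          liftOp t (∑ q : Fin n with q < p, Qop t q p)) *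
        iota t p (Fv t (RatFunc.X + (T.content p : Cu)))).prod

/-- The rational function `Z_ν(u) = (tr^{⊗ n} ⊗ id)(F_T(u))` with values in `U(𝔤)`. -/
def Zfun {ν : YoungDiagram} (T : StandardTableau ν n) (Φ : GroupRing (Fin n)) : Uu t :=
  (FT t T Φ).trace

end Trace

/-! ### The hyperoctahedral group and the characteristic maps -/

section Characteristic

variable (n : ℕ)

/-- The group ring of `S_{2n}`, the group of the permutations of `1, …, 2n`; the numbers
`1, …, n` are in the left summand and `n + 1, …, 2n` in the right one. -/
abbrev GR2 : Type := GroupRing (Fin n ⊕ Fin n)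

/-- The hyperoctahedral group `H_n`: the centralizer of `(1, n+1) ⋯ (n, 2n)` in `S_{2n}`. -/
def hyperoctahedral : Subgroup (Equiv.Perm (Fin n ⊕ Fin n)) :=
  Subgroup.centralizer {Equiv.sumComm (Fin n) (Fin n)}

open scoped Classical in
/-- The idempotent `h_+ = (1 / (n! 2^n)) ∑_{σ ∈ H_n} σ`. -/
def hPlus : GR2 n :=
  ((n.factorial : ℂ) * 2 ^ n)⁻¹ •
    ∑ σ : Equiv.Perm (Fin n ⊕ Fin n) with σ ∈ hyperoctahedral n, gr σ

open scoped Classical in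
/-- The idempotent `h_- = (1 / (n! 2^n)) ∑_{σ ∈ H_n} χ_-(σ) σ`.  The character `χ_-` of `H_n` is
trivial on `S_n` and takes `(s, n+s)` to `-1`, so it is the restriction of the sign character
of `S_{2n}` (see `sign_sumCongr_self` and `sign_swap_inl_inr`). -/
def hMinus : GR2 n :=
  ((n.factorial : ℂ) * 2 ^ n)⁻¹ •
    ∑ σ : Equiv.Perm (Fin n ⊕ Fin n) with σ ∈ hyperoctahedral n,
      ((Equiv.Perm.sign σ : ℤ) : ℂ) • gr σ

lemma sign_sumCongr_self (σ : Equiv.Perm (Fin n)) :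
    Equiv.Perm.sign (Equiv.Perm.sumCongr σ σ) = 1 := by
  rw [Equiv.Perm.sign_sumCongr, Int.units_mul_self]

lemma sign_swap_inl_inr (s : Fin n) :
    Equiv.Perm.sign (Equiv.swap (Sum.inl s) (Sum.inr s) : Equiv.Perm (Fin n ⊕ Fin n)) = -1 :=
  Equiv.Perm.sign_swap (by simp)

variable {n}

/-- The linear map `x ↦ h x h'` on the group ring of `S_{2n}`. -/
def sandwich (h h' : GR2 n) : GR2 n →ₗ[ℂ] GR2 n :=
  (LinearMap.mulRight ℂ h').comp (LinearMap.mulLeft ℂ h)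

/-- The subspace `h (ℂ · S_{2n}) h'`. -/
abbrev biSpace (h h' : GR2 n) : Submodule ℂ (GR2 n) := LinearMap.range (sandwich h h')

/-- The embedding `S_n → S_{2n}` by the permutations acting on `n + 1, …, 2n` trivially. -/
def embed (σ : Equiv.Perm (Fin n)) : Equiv.Perm (Fin n ⊕ Fin n) := Equiv.Perm.sumCongr σ 1

/-- The ring `Λ_M` of symmetric polynomials in `x_1, …, x_M`. -/
abbrev Lam (M : ℕ) : Subalgebra ℂ (MvPolynomial (Fin M) ℂ) :=
  MvPolynomial.symmetricSubalgebra (Fin M) ℂ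

/-- The defining property of the characteristic map `ch : h (ℂ · S_{2n}) h' → Λ_M` for `n = 2m`:
`ch (h σ h') = 2^{ℓ(ρ)} p_ρ(x_1², …, x_M²)` for every partition `ρ` of `m` and every
permutation `σ` of `1, …, n` with the cycle lengths `2ρ_1, 2ρ_2, …`. -/
def IsCharacteristicMap (m M : ℕ) (h h' : GR2 (2 * m)) (ch : biSpace h h' →ₗ[ℂ] Lam M) : Prop :=
  ∀ (ρ : m.Partition) (σ : Equiv.Perm (Fin (2 * m))),
    σ.cycleType = ρ.parts.map (fun k => 2 * k) →
      (ch ((sandwich h h').rangeRestrict (gr (embed σ))) : MvPolynomial (Fin M) ℂ) =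
        (2 : ℂ) ^ Multiset.card ρ.parts •
          MvPolynomial.expand 2 (MvPolynomial.psumPart (Fin M) ℂ ρ)

/-- The element `Ψ_T(u)` of the group ring of `S_{2n}` over `ℂ(u)`: the product over
`p = 1, …, n`, from the left to the right, of
`1 + ((1, n+p) + ⋯ + (p-1, n+p)) / (2u + c_p)`, times `Φ`.  Here `Φ` stands for `Φ_T`. -/
def Psi {ν : YoungDiagram} (T : StandardTableau ν n) (Φ : GroupRing (Fin n)) : Cu ⊗[ℂ] GR2 n :=
  (List.ofFn fun p : Fin n =>
      (1 + ((2 * RatFunc.X + (T.content p : Cu))⁻¹ : Cu) ⊗ₜ[ℂ]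
        (∑ q : Fin n with q < p, gr (Equiv.swap (Sum.inl q) (Sum.inr p))) :
          Cu ⊗[ℂ] GR2 n)).prod *
    (1 : Cu) ⊗ₜ[ℂ] (∑ σ : Equiv.Perm (Fin n), Φ.coeff σ • gr (embed σ))

/-- The image of `h Ψ h'` under the characteristic map `ch`, extended to `ℂ(u)`; the result is
regarded as an element of `ℂ[x_1, …, x_M] ⊗ ℂ(u)`. -/
def charImage {M : ℕ} {h h' : GR2 n} (ch : biSpace h h' →ₗ[ℂ] Lam M) (Ψ : Cu ⊗[ℂ] GR2 n) :
    Cu ⊗[ℂ] MvPolynomial (Fin M) ℂ :=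
  (Lam M).val.toLinearMap.baseChange Cu
    (ch.baseChange Cu ((sandwich h h').rangeRestrict.baseChange Cu Ψ))

end Characteristic

end Capelli

end

noncomputable section

namespace Capelli

attribute [local instance 100] LieRing.ofAssociativeRing

/-! ### The hyperoctahedral group and its double cosets -/

section Hyperoctahedral

variable {n : ℕ}

/-! Both sides are computed by one explicit linear function on the group ring of `S_{2n}`. Let `x_i`
be the image of `F_{ii}` in the polynomial ring, so that `x_{-i} = -x_i`. For `τ` in `S_{2n}` let
`charFun` be the pairing of `τ · g^{⊗n}`, where `g` is the invariant tensor of the form, with the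
`n`-th tensor power of the form twisted by `diag(x)`.

This function realizes the characteristic map. The form is symmetric for `so` and antisymmetric for
`sp`, and the twist reverses the symmetry. Hence left and right multiplication by `H_n` act on
`charFun` by opposite characters, and it factors through `h_- z h_+`, respectively `h_+ z h_-`
(`charFun_sandwich_so`, `charFun_sandwich_sp`). On `σ` in `S_n` it is the trace of `σ` weighted by
`x`, a product over the cycles of power sums of all `x_i`; a cycle of length `2k` contributes `2
p_k(x_1², …, x_M²)`, which is the required value. Uniqueness holds because every double coset of
`H_n` meets `S_n`, and an element of `S_n` with an odd cycle is killed by the two opposite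
idempotents (`exists_eq_mul_embed_mul`, `sandwich_gr_embed_eq_zero`).

On the other side, in top degree the scalar `-v-η` in `F(v)` drops out, and the projection to `ℂ[x]`
turns `∑ E_{ij} ⊗ F_{ji}` into `diag(x)`. So `f_ν` is the trace of `Y_T ∏ (1 + κ_p ∑_{q<p} Q_{qp})
diag(x)_p` with `κ_p = 1/(2u + c_p)` (`isLeadingPolynomial_scaledTrace`). That it depends only on
`Z_ν` is seen without the Poincaré–Birkhoff–Witt theorem, by letting `U(𝔤)` act by differential
operators on the power of a function vanishing at the identity (`leadingFun`).

The two sides meet when operators on `n` factors are read as tensors on `2n` factors. The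
transposition `(q, n+p)` then becomes the partial transpose of multiplication by `Q_{qp}`, and
cyclicity of the trace moves it to the place it has in `Z_ν` (`vecRep_swap_toVec`,
`trace_mul_transposedProd`). -/

lemma mem_hyperoctahedral_iff {h : Equiv.Perm (Fin n ⊕ Fin n)} :
    h ∈ hyperoctahedral n ↔ ∀ x, h x.swap = (h x).swap := by
  rw [hyperoctahedral, Subgroup.mem_centralizer_singleton_iff, Equiv.ext_iff]
  rfl

lemma sumCongr_self_mem (π : Equiv.Perm (Fin n)) :
    Equiv.Perm.sumCongr π π ∈ hyperoctahedral n := by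
  rw [mem_hyperoctahedral_iff]
  rintro (x | x) <;> simp

/-- The permutation exchanging `p` and `n + p` for all `p` in `C`. -/
def flipPerm (C : Finset (Fin n)) : Equiv.Perm (Fin n ⊕ Fin n) :=
  Function.Involutive.toPerm
    (Sum.elim (fun p => if p ∈ C then Sum.inr p else Sum.inl p)
      (fun p => if p ∈ C then Sum.inl p else Sum.inr p)) (by
    rintro (p | p) <;> by_cases hp : p ∈ C <;> simp [hp])

lemma flipPerm_inl (C : Finset (Fin n)) (p : Fin n) :
    flipPerm C (Sum.inl p) = if p ∈ C then Sum.inr p else Sum.inl p := rfl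

lemma flipPerm_inr (C : Finset (Fin n)) (p : Fin n) :
    flipPerm C (Sum.inr p) = if p ∈ C then Sum.inl p else Sum.inr p := rfl

lemma flipPerm_mem (C : Finset (Fin n)) : flipPerm C ∈ hyperoctahedral n := by
  rw [mem_hyperoctahedral_iff]
  rintro (p | p) <;> by_cases hp : p ∈ C <;> simp [flipPerm_inl, flipPerm_inr, hp]

lemma flipPerm_empty : flipPerm (∅ : Finset (Fin n)) = 1 := by
  ext (p | p) <;> simp [flipPerm_inl, flipPerm_inr]

lemma flipPerm_insert {C : Finset (Fin n)} {p : Fin n} (hp : p ∉ C) :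
    flipPerm (insert p C) = flipPerm C * Equiv.swap (Sum.inl p) (Sum.inr p) := by
  refine Equiv.ext ?_
  rintro (q | q) <;> by_cases hq : q = p
  · subst hq; simp [flipPerm_inl, flipPerm_inr, hp]
  · rw [Equiv.Perm.mul_apply, Equiv.swap_apply_of_ne_of_ne (by simpa using hq) (by simp)]
    simp [flipPerm_inl, hq]
  · subst hq; simp [flipPerm_inl, flipPerm_inr, hp]
  · rw [Equiv.Perm.mul_apply, Equiv.swap_apply_of_ne_of_ne (by simp) (by simpa using hq)]
    simp [flipPerm_inr, hq]

lemma sign_flipPerm (C : Finset (Fin n)) : Equiv.Perm.sign (flipPerm C) = (-1) ^ C.card := by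
  induction C using Finset.induction_on with
  | empty => simp [flipPerm_empty]
  | insert p C hp ih =>
    rw [flipPerm_insert hp, map_mul, ih, sign_swap_inl_inr, Finset.card_insert_of_notMem hp,
      pow_succ]

lemma eq_sumCongr_of_isRight {ρ : Equiv.Perm (Fin n ⊕ Fin n)}
    (h : ∀ x, (ρ x).isRight = x.isRight) : ∃ α β, ρ = Equiv.Perm.sumCongr α β := by
  have : Set.MapsTo ρ (Set.range Sum.inl) (Set.range Sum.inl) := by
    rintro _ ⟨x, rfl⟩
    have := h (Sum.inl x)
    rcases hx : ρ (Sum.inl x) with y | y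
    · exact ⟨y, rfl⟩
    · simp [hx] at this
  obtain ⟨⟨α, β⟩, hαβ⟩ := Equiv.Perm.mem_sumCongrHom_range_of_perm_mapsTo_inl this
  exact ⟨α, β, hαβ.symm⟩

/-- Every element of the hyperoctahedral group is a product of a diagonal permutation and
of a permutation exchanging `p` and `n + p` for several `p`. -/
lemma exists_eq_sumCongr_mul_flipPerm {h : Equiv.Perm (Fin n ⊕ Fin n)}
    (hh : h ∈ hyperoctahedral n) : ∃ π C, h = Equiv.Perm.sumCongr π π * flipPerm C := by
  classical
  rw [mem_hyperoctahedral_iff] at hh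
  -- `C` collects the pairs whose two halves `h` exchanges; undoing these flips leaves a permutation
  -- preserving each half.
  let C : Finset (Fin n) := Finset.univ.filter fun p => (h (Sum.inl p)).isRight
  obtain ⟨α, β, hαβ⟩ := eq_sumCongr_of_isRight (ρ := h * flipPerm C) (by
    rintro (p | p)
    · have := hh (Sum.inl p)
      rw [Sum.swap_inl] at this
      rcases hy : h (Sum.inl p) with y | y <;> rw [hy] at this <;>
        simp [flipPerm_inl, C, hy, this]
    · have := hh (Sum.inl p)
      rw [Sum.swap_inl] at this
      rcases hy : h (Sum.inl p) with y | y <;> rw [hy] at this <;>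
        simp [flipPerm_inr, C, hy, this])
  have hmul : ∀ x, (h * flipPerm C) x.swap = ((h * flipPerm C) x).swap :=
    mem_hyperoctahedral_iff.1 (mul_mem (mem_hyperoctahedral_iff.2 hh) (flipPerm_mem C))
  have : α = β := by
    ext p
    have := hmul (Sum.inl p)
    rw [hαβ] at this
    simp only [Sum.swap_inl, Equiv.Perm.sumCongr_apply, Sum.map_inl, Sum.map_inr,
      Sum.inr.injEq] at this
    rw [this]
  subst this
  refine ⟨α, C, ?_⟩
  rw [← hαβ, mul_assoc]
  refine Equiv.ext fun x => ?_
  rw [Equiv.Perm.mul_apply, Equiv.Perm.mul_apply]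
  congr 1
  rcases x with p | p <;> by_cases hp : p ∈ C <;> simp [flipPerm_inl, flipPerm_inr, hp]

/-- The union of two perfect matchings is a bipartite graph. -/
lemma exists_two_coloring {X : Type*} [Fintype X] (a b : Equiv.Perm X)
    (ha : ∀ x, a (a x) = x) (ha' : ∀ x, a x ≠ x) (hb : ∀ x, b (b x) = x) (hb' : ∀ x, b x ≠ x) :
    ∃ f : X → Bool, (∀ x, f (a x) = !f x) ∧ ∀ x, f (b x) = !f x := by
  classical
  have haa : a * a = 1 := Equiv.ext ha
  have hbb : b * b = 1 := Equiv.ext hb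
  have hai : a⁻¹ = a := inv_eq_of_mul_eq_one_right haa
  have hbi : b⁻¹ = b := inv_eq_of_mul_eq_one_right hbb
  let c : Equiv.Perm X := a * b
  have hconj : a * c * a⁻¹ = c⁻¹ := by
    simp only [c, mul_inv_rev, hai, hbi, ← mul_assoc, haa, one_mul]
  have hzpow : ∀ k : ℤ, a * c ^ k = c ^ (-k) * a := by
    intro k
    have := map_zpow (MulAut.conj a) c k
    simp only [MulAut.conj_apply, hconj] at this
    rw [zpow_neg, ← inv_zpow, ← this]
    simp
  -- Since `a` inverts `c = ab` by conjugation, `c ^ (2j) x = a x` would make `c ^ j x` a fixed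
  -- point of `a`, and `c ^ (2j+1) x = a x` would make it a fixed point of `b`.
  have hsame : ∀ x, ¬ c.SameCycle x (a x) := by
    rintro x ⟨k, hk⟩
    rcases Int.even_or_odd' k with ⟨j, rfl | rfl⟩
    · refine ha' ((c ^ j) x) ?_
      rw [← Equiv.Perm.mul_apply, hzpow, Equiv.Perm.mul_apply, ← hk, ← Equiv.Perm.mul_apply,
        ← zpow_add]
      congr 2
      ring
    · refine hb' ((c ^ j) x) ?_
      have h1 : a ((c ^ j) x) = c ((c ^ j) x) := by
        rw [← Equiv.Perm.mul_apply, hzpow, Equiv.Perm.mul_apply, ← hk, ← Equiv.Perm.mul_apply,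
          ← zpow_add, ← Equiv.Perm.mul_apply, ← zpow_one_add]
        congr 2
        ring
      exact a.injective h1.symm
  let s : Setoid X := Equiv.Perm.SameCycle.setoid c
  let e := Fintype.equivFin (Quotient s)
  let g : X → Fin (Fintype.card (Quotient s)) := fun x => e (Quotient.mk s x)
  have hg : ∀ x y, g x = g y ↔ c.SameCycle x y := by
    intro x y
    simp only [g, e.apply_eq_iff_eq]
    exact Quotient.eq
  have hne : ∀ x, g x ≠ g (a x) := fun x h => hsame x ((hg _ _).1 h)
  have hacb : ∀ x, a (c x) = b x := fun x => ha (b x)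
  have h1 : ∀ x, g (a (b x)) = g x := fun x => ((hg _ _).2 ⟨1, by simp [c]⟩).symm
  have h2 : ∀ x, g (b x) = g (a x) := fun x => ((hg _ _).2 ⟨-1, by
    have := congrArg (fun d : Equiv.Perm X => d x) (hzpow 1)
    simp only [zpow_one, Equiv.Perm.mul_apply] at this
    rw [← this, hacb]⟩).symm
  -- Both `a` and `b` exchange the cycle of `x` with the different cycle of `a x`. The numbering `g`
  -- of the cycles selects one colour in each such pair.
  refine ⟨fun x => decide (g x < g (a x)), fun x => ?_, fun x => ?_⟩
  · have := hne x
    simp only [ha, ← decide_not, decide_eq_decide]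
    omega
  · have := hne x
    simp only [h1, h2, ← decide_not, decide_eq_decide]
    omega

lemma exists_mem_hyperoctahedral_isRight {f : Fin n ⊕ Fin n → Bool}
    (hf : ∀ x, f x.swap = !f x) : ∃ h ∈ hyperoctahedral n, ∀ x, (h x).isRight = f x := by
  refine ⟨flipPerm (Finset.univ.filter fun p => f (Sum.inl p)), flipPerm_mem _, ?_⟩
  rintro (p | p)
  · by_cases hp : f (Sum.inl p) <;> simp [flipPerm_inl, hp]
  · have := hf (Sum.inl p)
    simp only [Sum.swap_inl] at this
    by_cases hp : f (Sum.inl p) <;> simp [flipPerm_inr, hp, this]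

/-- Every double coset of the hyperoctahedral group in `S_{2n}` contains an element
of `S_n`. -/
lemma exists_eq_mul_embed_mul (τ : Equiv.Perm (Fin n ⊕ Fin n)) :
    ∃ h ∈ hyperoctahedral n, ∃ h' ∈ hyperoctahedral n, ∃ σ, τ = h * embed σ * h' := by
  let a : Equiv.Perm (Fin n ⊕ Fin n) := Equiv.sumComm (Fin n) (Fin n)
  have ha : ∀ x, a (a x) = x := by rintro (x | x) <;> rfl
  have ha' : ∀ x, a x ≠ x := by rintro (x | x) <;> simp [a]
  -- The two matchings are `{s, n+s}` and its image under `τ`. A common colouring `f` lets `h`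
  -- straighten `f` and `k` straighten `f ∘ τ` to the division into left and right, so `h τ k⁻¹`
  -- preserves both halves.
  obtain ⟨f, hfa, hfb⟩ := exists_two_coloring a (τ * a * τ⁻¹) ha ha' (fun x => by simp [ha])
    (fun x h => ha' (τ⁻¹ x) (by
      rw [Equiv.Perm.mul_apply, Equiv.Perm.mul_apply] at h
      simpa using congrArg (⇑τ⁻¹) h))
  obtain ⟨h, hh, hhf⟩ := exists_mem_hyperoctahedral_isRight (f := f) hfa
  obtain ⟨k, hk, hkf⟩ := exists_mem_hyperoctahedral_isRight (f := fun x => f (τ x)) (by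
    intro x
    have := hfb (τ x)
    simpa [a] using this)
  obtain ⟨α, β, hαβ⟩ := eq_sumCongr_of_isRight (ρ := h * τ * k⁻¹) (by
    intro x
    rw [Equiv.Perm.mul_apply, Equiv.Perm.mul_apply, hhf, ← hkf]
    simp)
  refine ⟨h⁻¹, inv_mem hh, Equiv.Perm.sumCongr β β * k, mul_mem (sumCongr_self_mem β) hk,
    α * β⁻¹, ?_⟩
  have : embed (α * β⁻¹) * Equiv.Perm.sumCongr β β = Equiv.Perm.sumCongr α β := by
    simp [embed, Equiv.Perm.sumCongr_mul]
  rw [mul_assoc, ← mul_assoc (embed _), this, ← hαβ]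
  group

/-- If `σ ∈ S_n` has a cycle of odd length, which is reversed by `r`, then the double coset
of `σ` contains `σ` with the opposite sign. -/
lemma exists_odd_mul_embed {σ r : Equiv.Perm (Fin n)} {C : Finset (Fin n)} (hC : Odd C.card)
    (hr : ∀ x ∉ C, r x = x) (hσC : ∀ x, σ x ∈ C ↔ x ∈ C)
    (hrev : ∀ x ∈ C, σ (r (σ x)) = r x) :
    ∃ h ∈ hyperoctahedral n, ∃ k ∈ hyperoctahedral n, h * embed σ = embed σ * k ∧
      Equiv.Perm.sign h = -1 ∧ Equiv.Perm.sign k = -1 := by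
  have hhmem := mul_mem (sumCongr_self_mem r) (flipPerm_mem C)
  -- The diagonal part is even, so the sign of `h` is `(-1)^|C| = -1`.
  set h := Equiv.Perm.sumCongr r r * flipPerm C with hh
  have hs : Equiv.Perm.sign h = -1 := by
    rw [hh, map_mul, sign_sumCongr_self, sign_flipPerm, one_mul, hC.neg_one_pow]
  -- The conjugate of `h` stays in `H_n` because `σ r σ = r` on `C`: there it exchanges the halves
  -- through `r σ` in both directions.
  refine ⟨h, hhmem, (embed σ)⁻¹ * h * embed σ, ?_, by group, hs, ?_⟩
  · rw [mem_hyperoctahedral_iff]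
    have key : ∀ x y, h (embed σ x) = embed σ y → ((embed σ)⁻¹ * h * embed σ) x = y := by
      intro x y hxy
      rw [Equiv.Perm.mul_apply, Equiv.Perm.mul_apply, hxy]
      simp
    have h1 : ∀ p ∈ C, ((embed σ)⁻¹ * h * embed σ) (Sum.inl p) = Sum.inr (r (σ p)) :=
      fun p hp => key _ _ (by simp [hh, embed, flipPerm_inl, hσC, hp])
    have h2 : ∀ p ∈ C, ((embed σ)⁻¹ * h * embed σ) (Sum.inr p) = Sum.inl (r (σ p)) :=
      fun p hp => key _ _ (by simp [hh, embed, flipPerm_inr, hp, hrev])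
    have h3 : ∀ p ∉ C, ((embed σ)⁻¹ * h * embed σ) (Sum.inl p) = Sum.inl p :=
      fun p hp => key _ _ (by
        simp [hh, embed, flipPerm_inl, hσC, hp, hr (σ p) (fun h => hp ((hσC p).1 h))])
    have h4 : ∀ p ∉ C, ((embed σ)⁻¹ * h * embed σ) (Sum.inr p) = Sum.inr p :=
      fun p hp => key _ _ (by simp [hh, embed, flipPerm_inr, hp, hr])
    rintro (p | p) <;> by_cases hp : p ∈ C <;>
      simp only [Sum.swap_inl, Sum.swap_inr, h1 p, h2 p, h3 p, h4 p, hp, not_false_eq_true]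
  · rw [map_mul, map_mul, map_inv, hs]
    simp [mul_comm]

/-- `h` and `h'` are eigenvectors for the right and the left multiplication by the elements of the
hyperoctahedral group, with two characters whose product is the sign. -/
structure IsTwistedPair (h h' : GR2 n) (χ χ' : Equiv.Perm (Fin n ⊕ Fin n) →* ℤˣ) : Prop where
  left : ∀ k ∈ hyperoctahedral n, h * gr k = ((χ k : ℤ) : ℂ) • h
  right : ∀ k ∈ hyperoctahedral n, gr k * h' = ((χ' k : ℤ) : ℂ) • h'
  mul_eq_sign : ∀ k, χ k * χ' k = Equiv.Perm.sign k

/-- The symmetrizer of the hyperoctahedral group twisted by a character. -/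
def twistedSum (χ : Equiv.Perm (Fin n ⊕ Fin n) →* ℤˣ) : GR2 n := by
  classical exact
  ((n.factorial : ℂ) * 2 ^ n)⁻¹ •
    ∑ σ : Equiv.Perm (Fin n ⊕ Fin n) with σ ∈ hyperoctahedral n, ((χ σ : ℤ) : ℂ) • gr σ

lemma hPlus_eq_twistedSum : hPlus n = twistedSum 1 := by
  simp [hPlus, twistedSum]

lemma hMinus_eq_twistedSum : hMinus n = twistedSum Equiv.Perm.sign := rfl

lemma intCast_units_mul_self (u : ℤˣ) : ((u : ℤ) : ℂ) * ((u : ℤ) : ℂ) = 1 := by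
  rw [← Int.cast_mul, ← Units.val_mul, Int.units_mul_self]
  simp

lemma twistedSum_mul_gr (χ : Equiv.Perm (Fin n ⊕ Fin n) →* ℤˣ) {k : Equiv.Perm (Fin n ⊕ Fin n)}
    (hk : k ∈ hyperoctahedral n) : twistedSum χ * gr k = ((χ k : ℤ) : ℂ) • twistedSum χ := by
  classical
  rw [twistedSum, smul_mul_assoc, smul_comm]
  congr 1
  rw [Finset.sum_mul, Finset.smul_sum]
  refine Finset.sum_bij (fun σ _ => σ * k) (fun σ hσ => ?_) (fun _ _ _ _ h => mul_right_cancel h)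
    (fun σ hσ => ⟨σ * k⁻¹, ?_, by simp⟩) (fun σ hσ => ?_)
  · simp only [Finset.mem_filter, Finset.mem_univ, true_and] at hσ ⊢
    exact mul_mem hσ hk
  · simp only [Finset.mem_filter, Finset.mem_univ, true_and] at hσ ⊢
    exact mul_mem hσ (inv_mem hk)
  · rw [smul_mul_assoc, MonoidAlgebra.single_mul_single, one_mul, smul_smul, map_mul, Units.val_mul,
      Int.cast_mul, mul_left_comm, intCast_units_mul_self, mul_one]

lemma gr_mul_twistedSum (χ : Equiv.Perm (Fin n ⊕ Fin n) →* ℤˣ) {k : Equiv.Perm (Fin n ⊕ Fin n)}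
    (hk : k ∈ hyperoctahedral n) : gr k * twistedSum χ = ((χ k : ℤ) : ℂ) • twistedSum χ := by
  classical
  rw [twistedSum, mul_smul_comm, smul_comm]
  congr 1
  rw [Finset.mul_sum, Finset.smul_sum]
  refine Finset.sum_bij (fun σ _ => k * σ) (fun σ hσ => ?_) (fun _ _ _ _ h => mul_left_cancel h)
    (fun σ hσ => ⟨k⁻¹ * σ, ?_, by simp⟩) (fun σ hσ => ?_)
  · simp only [Finset.mem_filter, Finset.mem_univ, true_and] at hσ ⊢
    exact mul_mem hk hσ
  · simp only [Finset.mem_filter, Finset.mem_univ, true_and] at hσ ⊢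
    exact mul_mem (inv_mem hk) hσ
  · rw [mul_smul_comm, MonoidAlgebra.single_mul_single, one_mul, smul_smul, map_mul, Units.val_mul,
      Int.cast_mul, ← mul_assoc, intCast_units_mul_self, one_mul]

lemma isTwistedPair_hMinus_hPlus : IsTwistedPair (hMinus n) (hPlus n) Equiv.Perm.sign 1 where
  left _ hk := by rw [hMinus_eq_twistedSum, twistedSum_mul_gr _ hk]
  right _ hk := by rw [hPlus_eq_twistedSum, gr_mul_twistedSum _ hk]
  mul_eq_sign _ := by simp

lemma isTwistedPair_hPlus_hMinus : IsTwistedPair (hPlus n) (hMinus n) 1 Equiv.Perm.sign where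
  left _ hk := by rw [hPlus_eq_twistedSum, twistedSum_mul_gr _ hk]
  right _ hk := by rw [hMinus_eq_twistedSum, gr_mul_twistedSum _ hk]
  mul_eq_sign _ := by simp

lemma sandwich_apply (h h' x : GR2 n) : sandwich h h' x = h * x * h' := rfl

namespace IsTwistedPair

variable {h h' : GR2 n} {χ χ' : Equiv.Perm (Fin n ⊕ Fin n) →* ℤˣ}

lemma sandwich_mul_gr_mul (H : IsTwistedPair h h' χ χ') {k k' τ : Equiv.Perm (Fin n ⊕ Fin n)}
    (hk : k ∈ hyperoctahedral n) (hk' : k' ∈ hyperoctahedral n) :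
    sandwich h h' (gr (k * τ * k')) =
      (((χ k : ℤ) : ℂ) * ((χ' k' : ℤ) : ℂ)) • sandwich h h' (gr τ) := by
  have e : (gr (k * τ * k') : GR2 n) = gr k * gr τ * gr k' := by
    simp [MonoidAlgebra.single_mul_single]
  rw [sandwich_apply, e, ← mul_assoc, ← mul_assoc, H.left k hk, mul_assoc, H.right k' hk',
    sandwich_apply]
  simp only [smul_mul_assoc, mul_smul_comm, smul_smul, mul_comm]

/-- An odd cycle gives `k σ = σ k'` with `k`, `k'` odd elements of `H_n`. Absorbing `k` on the left
and `k'` on the right yields the scalars `χ(k)` and `χ'(k') = χ'(k)`, whose product is the sign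
`-1`. So the element equals its negative. -/
lemma sandwich_gr_embed_eq_zero (H : IsTwistedPair h h' χ χ') {σ : Equiv.Perm (Fin n)}
    (hσ : (∃ x, σ x = x) ∨ ∃ c ∈ σ.cycleFactorsFinset, Odd c.support.card) :
    sandwich h h' (gr (embed σ)) = 0 := by
  obtain ⟨C, r, hC, hr, hσC, hrev⟩ : ∃ (C : Finset (Fin n)) (r : Equiv.Perm (Fin n)),
      Odd C.card ∧ (∀ x ∉ C, r x = x) ∧ (∀ x, σ x ∈ C ↔ x ∈ C) ∧
        (∀ x ∈ C, σ (r (σ x)) = r x) := by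
    rcases hσ with ⟨x, hx⟩ | ⟨c, hc, hodd⟩
    · refine ⟨{x}, 1, by simp, by simp, fun y => ?_, ?_⟩
      · simp only [Finset.mem_singleton]
        exact ⟨fun h => σ.injective (h.trans hx.symm), fun h => by rw [h, hx]⟩
      · simp [hx]
    -- A cycle is conjugate to its inverse. A conjugating `d` satisfies `c d c = d` and preserves
    -- the support of `c`; its restriction there is the reversal `r`.
    · obtain ⟨d, hd⟩ := isConj_iff.1
        (Equiv.Perm.isConj_iff_cycleType_eq.2 (Equiv.Perm.cycleType_inv c).symm)
      have hdc : ∀ x, c (d (c x)) = d x := by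
        intro x
        have : c * d * c = d := by
          rw [mul_inv_eq_iff_eq_mul] at hd
          rw [mul_assoc, hd]
          group
        exact congrArg (fun e : Equiv.Perm (Fin n) => e x) this
      have hds : ∀ x, d x ∈ c.support ↔ x ∈ c.support := by
        intro x
        rw [Equiv.Perm.mem_support, Equiv.Perm.mem_support, not_iff_not]
        constructor
        · intro hx
          have := hdc (c⁻¹ x)
          simp only [Equiv.Perm.coe_inv, Equiv.apply_symm_apply] at this
          rw [hx] at this
          have := d.injective this
          rw [Equiv.eq_symm_apply] at this
          exact this
        · intro hx
          have := hdc x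
          rwa [hx] at this
      have hcσ := (Equiv.Perm.mem_cycleFactorsFinset_iff.1 hc).2
      have hσc : ∀ x, σ x ∈ c.support ↔ x ∈ c.support := by
        intro x
        have : c * σ = σ * c := (Equiv.Perm.self_mem_cycle_factors_commute hc).eq
        have h1 := congrArg (fun e : Equiv.Perm (Fin n) => e x) this
        simp only [Equiv.Perm.mul_apply] at h1
        rw [Equiv.Perm.mem_support, Equiv.Perm.mem_support, h1, σ.injective.ne_iff]
      have hr1 : ∀ x ∈ c.support, Equiv.Perm.ofSubtype (d.subtypePerm (p := (· ∈ c.support)) hds) x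
          = d x := by
        intro x hx
        rw [Equiv.Perm.ofSubtype_apply_of_mem _ hx]
        rfl
      refine ⟨c.support, Equiv.Perm.ofSubtype (d.subtypePerm (p := (· ∈ c.support)) hds), hodd,
        fun x hx => Equiv.Perm.ofSubtype_apply_of_not_mem _ hx, hσc, fun x hx => ?_⟩
      rw [hr1 _ ((hσc x).2 hx), hr1 _ hx, ← hcσ _ ((hds _).2 ((hσc x).2 hx)), ← hcσ _ hx, hdc]
  obtain ⟨k, hk, k', hk', hkk', hsk, hsk'⟩ := exists_odd_mul_embed hC hr hσC hrev
  have h1 := H.sandwich_mul_gr_mul (τ := embed σ) hk (one_mem _)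
  have h2 := H.sandwich_mul_gr_mul (τ := embed σ) (one_mem _) hk'
  rw [one_mul, ← hkk', ← mul_one (k * _), h1] at h2
  have e : χ' k' = χ' k := by
    have := congrArg χ' hkk'
    rw [map_mul, map_mul, mul_comm] at this
    exact (mul_left_cancel this).symm
  have e1 : ((χ k : ℤ) : ℂ) * ((χ' k' : ℤ) : ℂ) = -1 := by
    rw [e, ← Int.cast_mul, ← Units.val_mul, H.mul_eq_sign, hsk]
    simp
  rw [map_one, map_one, Units.val_one, Int.cast_one, one_mul, mul_one] at h2
  have h3 := congrArg (fun x => ((χ k : ℤ) : ℂ) • x) h2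
  simp only [smul_smul, intCast_units_mul_self, e1, one_smul, neg_smul] at h3
  have h4 : (2 : ℂ) • sandwich h h' (gr (embed σ)) = 0 := by
    rw [two_smul]
    exact add_eq_zero_iff_eq_neg.2 h3
  exact (smul_eq_zero.1 h4).resolve_left two_ne_zero

end IsTwistedPair

lemma exists_partition_of_even_cycles {m : ℕ} {σ : Equiv.Perm (Fin (2 * m))}
    (h0 : ∀ x, σ x ≠ x) (h1 : ∀ c ∈ σ.cycleFactorsFinset, Even c.support.card) :
    ∃ ρ : m.Partition, σ.cycleType = ρ.parts.map (fun k => 2 * k) := by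
  have heven : ∀ k ∈ σ.cycleType, 2 * (k / 2) = k := by
    intro k hk
    rw [Equiv.Perm.cycleType_def, Multiset.mem_map] at hk
    obtain ⟨c, hc, rfl⟩ := hk
    exact Nat.two_mul_div_two_of_even (h1 c hc)
  have hmap : (σ.cycleType.map (fun k => k / 2)).map (fun k => 2 * k) = σ.cycleType := by
    rw [Multiset.map_map]
    exact (Multiset.map_congr rfl heven).trans (Multiset.map_id _)
  -- `cycleType` omits fixed points, so its sum is `2m` only because there are none.
  have hsupp : σ.support = Finset.univ :=
    Finset.eq_univ_of_forall fun x => Equiv.Perm.mem_support.2 (h0 x)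
  refine ⟨⟨σ.cycleType.map (fun k => k / 2), fun {k} hk => ?_, ?_⟩, hmap.symm⟩
  · rw [Multiset.mem_map] at hk
    obtain ⟨l, hl, rfl⟩ := hk
    have := Equiv.Perm.two_le_of_mem_cycleType hl
    omega
  · have h2 := congrArg Multiset.sum hmap
    rw [Multiset.sum_map_mul_left, Multiset.map_id', Equiv.Perm.sum_cycleType, hsupp,
      Finset.card_univ, Fintype.card_fin] at h2
    omega

/-! ### Spanning elements, uniqueness and existence of the characteristic map -/

namespace IsTwistedPair

variable {m : ℕ} {h h' : GR2 (2 * m)}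
  {χ χ' : Equiv.Perm (Fin (2 * m) ⊕ Fin (2 * m)) →* ℤˣ}

/-- The double cosets of the permutations with even cycles span `h (ℂ · S_{2n}) h'`. -/
lemma sandwich_mem_span (H : IsTwistedPair h h' χ χ') (x : GR2 (2 * m)) :
    sandwich h h' x ∈ Submodule.span ℂ
      {y | ∃ (ρ : m.Partition) (σ : Equiv.Perm (Fin (2 * m))),
        σ.cycleType = ρ.parts.map (fun k => 2 * k) ∧ sandwich h h' (gr (embed σ)) = y} := by
  induction x using MonoidAlgebra.induction_linear with
  | zero => rw [map_zero]; exact zero_mem _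
  | add x y hx hy => rw [map_add]; exact add_mem hx hy
  | single τ c =>
    obtain ⟨k, hk, k', hk', σ, rfl⟩ := exists_eq_mul_embed_mul τ
    have : (MonoidAlgebra.single (k * embed σ * k') c : GR2 (2 * m)) =
        c • gr (k * embed σ * k') := by simp
    rw [this, map_smul, H.sandwich_mul_gr_mul hk hk']
    refine Submodule.smul_mem _ _ (Submodule.smul_mem _ _ ?_)
    by_cases hσ : (∃ x, σ x = x) ∨ ∃ c ∈ σ.cycleFactorsFinset, Odd c.support.card
    · rw [H.sandwich_gr_embed_eq_zero hσ]
      exact zero_mem _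
    · push Not at hσ
      obtain ⟨ρ, hρ⟩ := exists_partition_of_even_cycles hσ.1
        (fun c hc => Nat.not_odd_iff_even.1 (by simpa using hσ.2 c hc))
      exact Submodule.subset_span ⟨ρ, σ, hρ, rfl⟩

lemma isCharacteristicMap_unique (H : IsTwistedPair h h' χ χ') {M : ℕ}
    {ch₁ ch₂ : biSpace h h' →ₗ[ℂ] Lam M} (h₁ : IsCharacteristicMap m M h h' ch₁)
    (h₂ : IsCharacteristicMap m M h h' ch₂) : ch₁ = ch₂ := by
  have key : ∀ y ∈ Submodule.span ℂ
      {y | ∃ (ρ : m.Partition) (σ : Equiv.Perm (Fin (2 * m))),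
        σ.cycleType = ρ.parts.map (fun k => 2 * k) ∧ sandwich h h' (gr (embed σ)) = y},
      ∃ hy : y ∈ biSpace h h', ch₁ ⟨y, hy⟩ = ch₂ ⟨y, hy⟩ := by
    intro y hy
    induction hy using Submodule.span_induction with
    | mem y hy =>
      obtain ⟨ρ, σ, hσ, rfl⟩ := hy
      exact ⟨⟨_, rfl⟩, Subtype.ext ((h₁ ρ σ hσ).trans (h₂ ρ σ hσ).symm)⟩
    | zero => exact ⟨zero_mem _, by rw [show (⟨0, _⟩ : biSpace h h') = 0 from rfl]; simp⟩
    | add x y _ _ hx hy =>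
      obtain ⟨hx, ex⟩ := hx
      obtain ⟨hy, ey⟩ := hy
      refine ⟨add_mem hx hy, ?_⟩
      rw [show (⟨x + y, _⟩ : biSpace h h') = ⟨x, hx⟩ + ⟨y, hy⟩ from rfl, map_add, map_add, ex, ey]
    | smul c x _ hx =>
      obtain ⟨hx, ex⟩ := hx
      refine ⟨Submodule.smul_mem _ _ hx, ?_⟩
      rw [show (⟨c • x, _⟩ : biSpace h h') = c • ⟨x, hx⟩ from rfl, map_smul, map_smul, ex]
  refine LinearMap.ext ?_
  rintro ⟨_, x, rfl⟩
  exact (key _ (H.sandwich_mem_span x)).2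

/-- A linear function on the group ring which transforms under the hyperoctahedral group as
`h x h'` does, and takes the prescribed values, gives rise to a characteristic map. -/
lemma exists_isCharacteristicMap (H : IsTwistedPair h h' χ χ') {M : ℕ}
    (L : GR2 (2 * m) →ₗ[ℂ] MvPolynomial (Fin M) ℂ) (hL : ∀ x, L (sandwich h h' x) = L x)
    (hval : ∀ (ρ : m.Partition) (σ : Equiv.Perm (Fin (2 * m))),
      σ.cycleType = ρ.parts.map (fun k => 2 * k) → L (gr (embed σ)) =
        (2 : ℂ) ^ Multiset.card ρ.parts •
          MvPolynomial.expand 2 (MvPolynomial.psumPart (Fin M) ℂ ρ)) :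
    ∃ ch : biSpace h h' →ₗ[ℂ] Lam M, IsCharacteristicMap m M h h' ch ∧
      ∀ Ψ, charImage ch Ψ = L.baseChange Cu Ψ := by
  -- Nothing forces a general value of `L` to be symmetric; on `h (ℂ · S_{2n}) h'` it follows from
  -- the spanning elements, whose values are products of power sums.
  have hsymm : ∀ y : biSpace h h', L y ∈ Subalgebra.toSubmodule (Lam M) := by
    rintro ⟨_, x, rfl⟩
    refine (Submodule.span_le (p := (Subalgebra.toSubmodule (Lam M)).comap L)).2 ?_
      (H.sandwich_mem_span x)
    rintro _ ⟨ρ, σ, hσ, rfl⟩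
    change L _ ∈ Lam M
    rw [hL, hval ρ σ hσ]
    refine Subalgebra.smul_mem _ ?_ _
    rw [MvPolynomial.mem_symmetricSubalgebra]
    intro e
    rw [MvPolynomial.rename_expand, MvPolynomial.psumPart, map_multiset_prod, Multiset.map_map]
    simp only [Function.comp_apply, MvPolynomial.psum_isSymmetric _ _ _ e]
  refine ⟨(L.comp (biSpace h h').subtype).codRestrict (Subalgebra.toSubmodule (Lam M)) hsymm,
    fun ρ σ hσ => ?_, fun Ψ => ?_⟩
  · rw [← hval ρ σ hσ, ← hL]
    rfl
  · unfold charImage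
    rw [← LinearMap.comp_apply, ← LinearMap.comp_apply, ← LinearMap.baseChange_comp,
      ← LinearMap.baseChange_comp]
    congr 2
    exact LinearMap.ext hL

end IsTwistedPair

end Hyperoctahedral

/-! ### The order of the hyperoctahedral group -/

section Order

variable {n : ℕ}

-- The factorization into a diagonal permutation and a flip is unique. The count shows that the
-- normalization of `twistedSum` is that of an average.
open scoped Classical in
lemma card_hyperoctahedral :
    (Finset.univ.filter fun σ : Equiv.Perm (Fin n ⊕ Fin n) => σ ∈ hyperoctahedral n).card =
      n.factorial * 2 ^ n := by
  have h1 : (Finset.univ : Finset (Equiv.Perm (Fin n) × Finset (Fin n))).card =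
      n.factorial * 2 ^ n := by
    rw [Finset.card_univ, Fintype.card_prod, Fintype.card_perm, Fintype.card_finset,
      Fintype.card_fin]
  rw [← h1]
  symm
  refine Finset.card_bij (fun a _ => Equiv.Perm.sumCongr a.1 a.1 * flipPerm a.2)
    (fun a _ => ?_) ?_ (fun σ hσ => ?_)
  · simpa using mul_mem (sumCongr_self_mem a.1) (flipPerm_mem a.2)
  · rintro ⟨π, C⟩ - ⟨π', C'⟩ - h
    have key : ∀ p, Equiv.Perm.sumCongr π π (flipPerm C (Sum.inl p)) =
        Equiv.Perm.sumCongr π' π' (flipPerm C' (Sum.inl p)) := fun p =>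
      congrArg (fun e : Equiv.Perm (Fin n ⊕ Fin n) => e (Sum.inl p)) h
    simp only [flipPerm_inl] at key
    refine Prod.ext (Equiv.ext fun p => ?_) (Finset.ext fun p => ?_)
    · have := key p
      by_cases hp : p ∈ C <;> by_cases hp' : p ∈ C' <;> simp [hp, hp'] at this ⊢ <;> exact this
    · have := key p
      by_cases hp : p ∈ C <;> by_cases hp' : p ∈ C' <;> simp [hp, hp'] at this ⊢
  · obtain ⟨π, C, h⟩ := exists_eq_sumCongr_mul_flipPerm (by simpa using hσ)
    exact ⟨(π, C), Finset.mem_univ _, h.symm⟩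

variable {V : Type*} [AddCommGroup V] [Module ℂ V]

/-- Every term of the average contributes `χ(k)² L(x) = L(x)`. With its mirror image below, this
makes a function with the right symmetry factor through `sandwich`. -/
lemma map_twistedSum_mul (L : GR2 n →ₗ[ℂ] V) {χ : Equiv.Perm (Fin n ⊕ Fin n) →* ℤˣ}
    (hL : ∀ k ∈ hyperoctahedral n, ∀ x, L (gr k * x) = ((χ k : ℤ) : ℂ) • L x) (x : GR2 n) :
    L (twistedSum χ * x) = L x := by
  classical
  rw [twistedSum, smul_mul_assoc, map_smul, Finset.sum_mul, map_sum]
  rw [Finset.sum_congr rfl (g := fun _ => L x) (fun k hk => by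
    rw [smul_mul_assoc, map_smul, hL k (by simpa using hk), smul_smul, intCast_units_mul_self,
      one_smul])]
  rw [Finset.sum_const, card_hyperoctahedral, ← Nat.cast_smul_eq_nsmul ℂ, smul_smul]
  rw [Nat.cast_mul, Nat.cast_pow, Nat.cast_ofNat, inv_mul_cancel₀, one_smul]
  exact mul_ne_zero (Nat.cast_ne_zero.2 n.factorial_ne_zero) (pow_ne_zero _ two_ne_zero)

lemma map_mul_twistedSum (L : GR2 n →ₗ[ℂ] V) {χ : Equiv.Perm (Fin n ⊕ Fin n) →* ℤˣ}
    (hL : ∀ k ∈ hyperoctahedral n, ∀ x, L (x * gr k) = ((χ k : ℤ) : ℂ) • L x) (x : GR2 n) :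
    L (x * twistedSum χ) = L x := by
  classical
  rw [twistedSum, mul_smul_comm, map_smul, Finset.mul_sum, map_sum]
  rw [Finset.sum_congr rfl (g := fun _ => L x) (fun k hk => by
    rw [mul_smul_comm, map_smul, hL k (by simpa using hk), smul_smul, intCast_units_mul_self,
      one_smul])]
  rw [Finset.sum_const, card_hyperoctahedral, ← Nat.cast_smul_eq_nsmul ℂ, smul_smul]
  rw [Nat.cast_mul, Nat.cast_pow, Nat.cast_ofNat, inv_mul_cancel₀, one_smul]
  exact mul_ne_zero (Nat.cast_ne_zero.2 n.factorial_ne_zero) (pow_ne_zero _ two_ne_zero)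

end Order

/-! ### Products of a form over the pairs `p, n + p` -/

section PairProduct

variable {n : ℕ} {I R : Type*} [CommRing R]

/-- The product of the values of a bilinear form at the pairs `c_p, c_{n+p}`. -/
def pairProd (G : I → I → R) (c : Fin n ⊕ Fin n → I) : R :=
  ∏ p, G (c (Sum.inl p)) (c (Sum.inr p))

lemma pairProd_comp_sumCongr (G : I → I → R) (c : Fin n ⊕ Fin n → I) (π : Equiv.Perm (Fin n)) :
    pairProd G (c ∘ Equiv.Perm.sumCongr π π) = pairProd G c :=
  Equiv.prod_comp π fun p => G (c (Sum.inl p)) (c (Sum.inr p))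

lemma pairProd_comp_flipPerm {G : I → I → R} {u : R} (hG : ∀ i j, G j i = u * G i j)
    (c : Fin n ⊕ Fin n → I) (C : Finset (Fin n)) :
    pairProd G (c ∘ flipPerm C) = u ^ C.card * pairProd G c := by
  have : ∀ p, G ((c ∘ flipPerm C) (Sum.inl p)) ((c ∘ flipPerm C) (Sum.inr p)) =
      (if p ∈ C then u else 1) * G (c (Sum.inl p)) (c (Sum.inr p)) := by
    intro p
    by_cases hp : p ∈ C
    · simp [flipPerm_inl, flipPerm_inr, hp, hG (c (Sum.inl p)) (c (Sum.inr p))]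
    · simp [flipPerm_inl, flipPerm_inr, hp]
  rw [pairProd, Finset.prod_congr rfl fun p _ => this p, Finset.prod_mul_distrib,
    Finset.prod_ite_mem, Finset.univ_inter, Finset.prod_const, pairProd]

lemma pairProd_comp_of_symm {G : I → I → R} (hG : ∀ i j, G j i = G i j)
    (c : Fin n ⊕ Fin n → I) {k : Equiv.Perm (Fin n ⊕ Fin n)} (hk : k ∈ hyperoctahedral n) :
    pairProd G (c ∘ k) = pairProd G c := by
  obtain ⟨π, C, rfl⟩ := exists_eq_sumCongr_mul_flipPerm hk
  rw [Equiv.Perm.coe_mul, ← Function.comp_assoc,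
    pairProd_comp_flipPerm (u := 1) (fun i j => by rw [hG, one_mul]), one_pow, one_mul,
    pairProd_comp_sumCongr]

lemma pairProd_comp_of_antisymm {G : I → I → R} (hG : ∀ i j, G j i = -G i j)
    (c : Fin n ⊕ Fin n → I) {k : Equiv.Perm (Fin n ⊕ Fin n)} (hk : k ∈ hyperoctahedral n) :
    pairProd G (c ∘ k) = ((Equiv.Perm.sign k : ℤ) : R) * pairProd G c := by
  obtain ⟨π, C, rfl⟩ := exists_eq_sumCongr_mul_flipPerm hk
  rw [Equiv.Perm.coe_mul, ← Function.comp_assoc,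
    pairProd_comp_flipPerm (u := -1) (fun i j => by rw [hG, neg_one_mul]),
    pairProd_comp_sumCongr, map_mul, sign_sumCongr_self, sign_flipPerm, one_mul]
  simp

end PairProduct

/-! ### The tensor representation of `S_{2n}` and the characteristic function -/

section CharFun

variable {t : ClassicalType} {n : ℕ} {R : Type*} [CommRing R]

/-- The coordinates of a tensor in `(R^N)^{⊗ 2n}`. -/
abbrev Vec (t : ClassicalType) (n : ℕ) (R : Type*) : Type _ := (Fin n ⊕ Fin n → t.Idx) → R

/-- The action of `S_{2n}` in `(R^N)^{⊗ 2n}`, linear over a ring of scalars `K`. -/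
def vecRep (t : ClassicalType) (n : ℕ) (K R : Type*) [CommRing K] [CommRing R] [Algebra K R] :
    Equiv.Perm (Fin n ⊕ Fin n) →* Module.End K (Vec t n R) where
  toFun τ := LinearMap.funLeft K R fun c => c ∘ τ
  map_one' := rfl
  map_mul' _ _ := rfl

lemma vecRep_apply {K : Type*} [CommRing K] [Algebra K R] (τ : Equiv.Perm (Fin n ⊕ Fin n))
    (y : Vec t n R) (c : Fin n ⊕ Fin n → t.Idx) : vecRep t n K R τ y c = y (c ∘ τ) := rfl

variable [Algebra ℂ R]

/-- The Gram matrix of the form, with entries in `R`. -/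
def gram (t : ClassicalType) (R : Type*) [CommRing R] [Algebra ℂ R] (i j : t.Idx) : R :=
  if j = -i then algebraMap ℂ R (t.eps i) else 0

/-- The invariant vector `(∑ ε_i e_i ⊗ e_{-i})^{⊗ n}`. -/
def formVec (t : ClassicalType) (n : ℕ) (R : Type*) [CommRing R] [Algebra ℂ R] : Vec t n R :=
  pairProd (gram t R)

/-- The pairing of tensors with the `n`-th tensor power of the form twisted by the diagonal matrix
with the entries `x`. -/
def pairing (K : Type*) [CommRing K] [Algebra K R] (x : t.Idx → R) (n : ℕ) :
    Vec t n R →ₗ[K] R where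
  toFun y := ∑ c, pairProd (fun i j => gram t R i j * x i) c * y c
  map_add' y z := by simp [mul_add, Finset.sum_add_distrib]
  map_smul' a y := by simp [Finset.smul_sum]

lemma pairing_apply {K : Type*} [CommRing K] [Algebra K R] (x : t.Idx → R) (y : Vec t n R) :
    pairing K x n y = ∑ c, pairProd (fun i j => gram t R i j * x i) c * y c := rfl

/-- The characteristic function on the group ring of `S_{2n}`. -/
def charFun (x : t.Idx → R) (n : ℕ) : GR2 n →ₗ[ℂ] R :=
  pairing ℂ x n ∘ₗ LinearMap.applyₗ (formVec t n R) ∘ₗ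
    (MonoidAlgebra.lift ℂ _ _ (vecRep t n ℂ R)).toLinearMap

lemma charFun_apply (x : t.Idx → R) (z : GR2 n) :
    charFun x n z = pairing ℂ x n (MonoidAlgebra.lift ℂ _ _ (vecRep t n ℂ R) z (formVec t n R)) :=
  rfl

lemma charFun_gr (x : t.Idx → R) (τ : Equiv.Perm (Fin n ⊕ Fin n)) :
    charFun x n (gr τ) = ∑ c, pairProd (fun i j => gram t R i j * x i) c *
      pairProd (gram t R) (c ∘ τ) := by
  rw [charFun_apply, MonoidAlgebra.lift_single, one_smul]
  rfl

lemma charFun_mul_gr (x : t.Idx → R) {χ : Equiv.Perm (Fin n ⊕ Fin n) →* ℤˣ}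
    (hχ : ∀ k ∈ hyperoctahedral n, ∀ c, pairProd (gram t R) (c ∘ k) =
      ((χ k : ℤ) : R) * pairProd (gram t R) c) :
    ∀ k ∈ hyperoctahedral n, ∀ z, charFun x n (z * gr k) = ((χ k : ℤ) : ℂ) • charFun x n z := by
  intro k hk z
  induction z using MonoidAlgebra.induction_linear with
  | zero => simp
  | add x y hx hy => rw [add_mul, map_add, map_add, hx, hy, smul_add]
  | single τ a =>
    have h1 : (MonoidAlgebra.single τ a : GR2 n) = a • gr τ := by simp
    rw [h1, smul_mul_assoc, map_smul, map_smul, smul_comm]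
    congr 1
    rw [MonoidAlgebra.single_mul_single, one_mul, charFun_gr, charFun_gr, Finset.smul_sum]
    refine Finset.sum_congr rfl fun c _ => ?_
    rw [Equiv.Perm.coe_mul, ← Function.comp_assoc, hχ k hk, Algebra.smul_def, map_intCast,
      mul_left_comm]

lemma charFun_gr_mul (x : t.Idx → R) {χ : Equiv.Perm (Fin n ⊕ Fin n) →* ℤˣ}
    (hχ : ∀ k ∈ hyperoctahedral n, ∀ c, pairProd (fun i j => gram t R i j * x i) (c ∘ k) =
      ((χ k : ℤ) : R) * pairProd (fun i j => gram t R i j * x i) c) :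
    ∀ k ∈ hyperoctahedral n, ∀ z, charFun x n (gr k * z) = ((χ k : ℤ) : ℂ) • charFun x n z := by
  intro k hk z
  induction z using MonoidAlgebra.induction_linear with
  | zero => simp
  | add x y hx hy => rw [mul_add, map_add, map_add, hx, hy, smul_add]
  | single τ a =>
    have h1 : (MonoidAlgebra.single τ a : GR2 n) = a • gr τ := by simp
    rw [h1, mul_smul_comm, map_smul, map_smul, smul_comm]
    congr 1
    rw [MonoidAlgebra.single_mul_single, one_mul, charFun_gr, charFun_gr, Finset.smul_sum]
    -- Substituting `c ∘ k⁻¹` for `c` transfers `k` from the invariant vector to the twisted form.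
    rw [← Equiv.sum_comp (Equiv.arrowCongr k (Equiv.refl t.Idx))]
    refine Finset.sum_congr rfl fun c _ => ?_
    have e1 : (Equiv.arrowCongr k (Equiv.refl t.Idx)) c ∘ ⇑(k * τ) = c ∘ τ := by
      ext p; simp
    have e2 : c = (Equiv.arrowCongr k (Equiv.refl t.Idx)) c ∘ k := by
      ext p; simp
    rw [e1]
    conv_rhs => rw [e2, hχ k hk, ← e2]
    rw [Algebra.smul_def, map_intCast, ← mul_assoc, ← mul_assoc]
    congr 2
    rw [← Int.cast_mul, ← Units.val_mul, Int.units_mul_self]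
    simp

end CharFun

/-! ### Traces over the functions constant on the cycles of a permutation -/

lemma eq_of_sameCycle {α I : Type*} [Finite α] {σ : Equiv.Perm α} {a : α → I}
    (ha : ∀ p, a (σ p) = a p) {p q : α} (h : σ.SameCycle p q) : a p = a q := by
  obtain ⟨k, rfl⟩ := h.exists_nat_pow_eq
  clear h
  induction k with
  | zero => rfl
  | succ k ih => rw [pow_succ', Equiv.Perm.mul_apply, ha, ← ih]

/-- Only functions constant on the cycles of `σ` contribute. Such a function is a free choice of one
value per cycle, and a cycle of length `k` with value `i` has weight `x_i ^ k`. As `σ` has no fixed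
points, `cycleType` lists all its cycles. -/
lemma sum_prod_ite_eq_prod_cycleType {α I R : Type*} [Fintype α] [DecidableEq α] [Fintype I]
    [DecidableEq I] [CommRing R] (σ : Equiv.Perm α) (hσ : ∀ p, σ p ≠ p) (x : I → R) :
    ∑ a : α → I, ∏ p, (if a (σ p) = a p then x (a p) else 0) =
      (σ.cycleType.map fun k => ∑ i, x i ^ k).prod := by
  have hmem : ∀ p, σ.cycleOf p ∈ σ.cycleFactorsFinset := fun p =>
    Equiv.Perm.cycleOf_mem_cycleFactorsFinset_iff.2 (Equiv.Perm.mem_support.2 (hσ p))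
  have hrep : ∀ c : σ.cycleFactorsFinset, ∃ p, c = ⟨σ.cycleOf p, hmem p⟩ := by
    rintro ⟨c, hc⟩
    obtain ⟨p, hp⟩ := (Equiv.Perm.mem_cycleFactorsFinset_iff.1 hc).1.nonempty_support
    exact ⟨p, Subtype.ext
      ((Equiv.Perm.eq_cycleOf_of_mem_cycleFactorsFinset_iff σ c hc p).2 hp)⟩
  rw [Equiv.Perm.cycleType_def, Multiset.map_map]
  change _ = ∏ c ∈ σ.cycleFactorsFinset, ∑ i, x i ^ c.support.card
  rw [← Finset.prod_coe_sort, Fintype.prod_sum]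
  symm
  refine Fintype.sum_of_injective (fun b p => b ⟨σ.cycleOf p, hmem p⟩) ?_ _ _ ?_ ?_
  · intro b b' h
    funext c
    obtain ⟨p, rfl⟩ := hrep c
    exact congrFun h p
  · intro a ha
    by_contra h0
    have hconst : ∀ p, a (σ p) = a p := by
      intro p
      by_contra hp
      exact h0 (Finset.prod_eq_zero (Finset.mem_univ p) (if_neg hp))
    choose r hr using hrep
    refine ha ⟨fun c => a (r c), funext fun p => (eq_of_sameCycle hconst ?_)⟩
    have h1 : σ.cycleOf p = σ.cycleOf (r ⟨σ.cycleOf p, hmem p⟩) :=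
      congrArg Subtype.val (hr ⟨σ.cycleOf p, hmem p⟩)
    have h2 : p ∈ (σ.cycleOf p).support := by simp [hσ]
    rw [h1] at h2
    exact (Equiv.Perm.mem_support_cycleOf_iff.1 h2).1
  · intro b
    have h1 : ∀ p, (⟨σ.cycleOf (σ p), hmem (σ p)⟩ : σ.cycleFactorsFinset) =
        ⟨σ.cycleOf p, hmem p⟩ := fun p =>
      Subtype.ext (Equiv.Perm.cycleOf_self_apply σ p)
    simp only [h1, if_true]
    rw [← Fintype.prod_fiberwise (fun p => (⟨σ.cycleOf p, hmem p⟩ : σ.cycleFactorsFinset))]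
    refine Finset.prod_congr rfl fun c _ => ?_
    have h2 : ∀ p : {p // (⟨σ.cycleOf p, hmem p⟩ : σ.cycleFactorsFinset) = c},
        x (b ⟨σ.cycleOf p.1, hmem p.1⟩) = x (b c) := fun p => by rw [p.2]
    rw [Finset.prod_congr rfl fun p _ => h2 p, Finset.prod_const, Finset.card_univ,
      Fintype.card_subtype]
    congr 2
    ext p
    rw [Finset.mem_filter_univ, Subtype.ext_iff,
      ← Equiv.Perm.eq_cycleOf_of_mem_cycleFactorsFinset_iff σ c.1 c.2 p, eq_comm]

/-! ### The coordinates of the Cartan subalgebra -/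

namespace ClassicalType

variable (t : ClassicalType)

/-- The image of `F_{ii}` under the projection to `ℂ[x_1, …, x_M]`. -/
def coord (i : t.Idx) : MvPolynomial (Fin t.rank) ℂ := t.cartanProj (t.F i i)

lemma cartanProj_F (i j : t.Idx) : t.cartanProj (t.F i j) = if i = j then t.coord i else 0 := by
  split_ifs with h
  · rw [h, coord]
  · exact t.cartanProj_F_of_ne h

lemma coord_neg (i : t.Idx) : t.coord (-i) = -t.coord i := by
  rw [coord, coord, ← map_neg]
  congr 1
  refine Subtype.ext ?_
  have h : t.eps (-i) * t.eps (-i) = 1 := t.eps_mul_self (-i)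
  change Fmat t (-i) (-i) = -(Fmat t i i)
  rw [Fmat, Fmat, h, t.eps_mul_self, Idx.neg_neg, one_smul, one_smul]
  abel

lemma coord_negIdx (k : Fin t.rank) : t.coord (t.negIdx k) = MvPolynomial.X k :=
  t.cartanProj_F_negIdx k

/-- The coordinates are `x_k`, `-x_k` and possibly `0`; in an even positive power each `x_k` counts
twice and the zero index disappears. This `2`, taken once for each part, is the source of
`2^{ℓ(ρ)}`. -/
lemma sum_coord_pow {k : ℕ} (hk : k ≠ 0) :
    ∑ i, t.coord i ^ (2 * k) = 2 * MvPolynomial.expand 2 (MvPolynomial.psum (Fin t.rank) ℂ k) := by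
  have hneg : ∀ i j : t.Idx, -i = -j → i = j := fun i j h => by
    rw [← Idx.neg_neg i, h, Idx.neg_neg]
  have hval : ∀ k, (t.negIdx k : ℤ) = (k : ℤ) - t.rank := fun k => rfl
  rw [← Fintype.sum_of_injective
    (Sum.elim t.negIdx fun k => -t.negIdx k)
    ?_ (Sum.elim (fun l => MvPolynomial.X l ^ (2 * k)) fun l => MvPolynomial.X l ^ (2 * k)) _ ?_ ?_]
  · simp only [Fintype.sum_sum_type, Sum.elim_inl, Sum.elim_inr, MvPolynomial.psum, map_sum,
      map_pow, MvPolynomial.expand_X, ← pow_mul, two_mul]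
  · rintro (k | k) (l | l) h <;> have h' := congrArg Subtype.val h <;>
      simp only [Sum.elim_inl, Sum.elim_inr, Idx.coe_neg, hval] at h' <;>
      have := k.2 <;> have := l.2
    · congr 1; ext; omega
    · omega
    · omega
    · congr 1; ext; omega
  · intro i hi
    have h0 : (i : ℤ) = 0 := by
      by_contra h
      refine hi ?_
      have hi := i.2
      simp only [idxFinset, Finset.mem_filter, Finset.mem_Icc] at hi
      rcases lt_or_gt_of_ne h with h | h
      · refine ⟨Sum.inl ⟨((i : ℤ) + t.rank).toNat, by omega⟩, Subtype.ext ?_⟩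
        simp only [Sum.elim_inl, hval]
        omega
      · refine ⟨Sum.inr ⟨(-(i : ℤ) + t.rank).toNat, by omega⟩, Subtype.ext ?_⟩
        simp only [Sum.elim_inr, Idx.coe_neg, hval]
        omega
    rw [coord, t.cartanProj_F_zero h0, zero_pow (by omega)]
  · rintro (l | l)
    · simp [coord_negIdx]
    · simp [coord_neg, coord_negIdx]

end ClassicalType

/-! ### The values of the characteristic function -/

section CharFunValues

variable {t : ClassicalType} {n : ℕ} {R : Type*} [CommRing R] [Algebra ℂ R]

/-- The form pairs `e_i` with `e_{-i}` only, so the left half of an index determines the right half.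
-/
lemma pairing_eq_sum {K : Type*} [CommRing K] [Algebra K R] (x : t.Idx → R) (y : Vec t n R) :
    pairing K x n y = ∑ a : Fin n → t.Idx,
      (∏ p, algebraMap ℂ R (t.eps (a p)) * x (a p)) * y (Sum.elim a fun p => -a p) := by
  rw [pairing_apply]
  symm
  refine Fintype.sum_of_injective (fun a => Sum.elim a fun p => -a p) ?_ _ _ ?_ ?_
  · intro a b h
    funext p
    exact congrFun h (Sum.inl p)
  · intro c hc
    obtain ⟨p, hp⟩ : ∃ p, c (Sum.inr p) ≠ -c (Sum.inl p) := by
      by_contra! h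
      refine hc ⟨fun p => c (Sum.inl p), ?_⟩
      funext q
      rcases q with q | q
      · rfl
      · exact (h q).symm
    rw [pairProd, Finset.prod_eq_zero (Finset.mem_univ p), zero_mul]
    rw [gram, if_neg hp, zero_mul]
  · intro a
    simp [pairProd, gram]

/-- Each sign `ε` occurs twice, once from the form and once from the invariant vector, and cancels.
What remains is the trace of `σ` weighted by `x`. -/
lemma charFun_gr_embed (x : t.Idx → R) (σ : Equiv.Perm (Fin n)) :
    charFun x n (gr (embed σ)) =
      ∑ a : Fin n → t.Idx, ∏ p, (if a (σ p) = a p then x (a p) else 0) := by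
  rw [charFun_apply, MonoidAlgebra.lift_single, one_smul, pairing_eq_sum]
  refine Finset.sum_congr rfl fun a => ?_
  intro _
  rw [vecRep_apply, formVec, pairProd, ← Finset.prod_mul_distrib]
  refine Finset.prod_congr rfl fun p _ => ?_
  by_cases h : a (σ p) = a p
  · have : algebraMap ℂ R (t.eps (a p)) * algebraMap ℂ R (t.eps (a p)) = 1 := by
      rw [← map_mul, t.eps_mul_self, map_one]
    simp only [embed, Function.comp_apply, Equiv.Perm.sumCongr_apply, Sum.map_inl, Sum.map_inr,
      Sum.elim_inl, Sum.elim_inr, Equiv.Perm.coe_one, id_eq, gram, h, if_true]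
    rw [mul_right_comm, this, one_mul]
  · have h' : ¬ (-a p = -a (σ p)) := fun h' => h (by
      rw [← ClassicalType.Idx.neg_neg (a (σ p)), ← h', ClassicalType.Idx.neg_neg])
    simp [embed, gram, h, h']

lemma charFun_coord_gr_embed {m : ℕ} (ρ : m.Partition) (σ : Equiv.Perm (Fin (2 * m)))
    (hσ : σ.cycleType = ρ.parts.map (fun k => 2 * k)) :
    charFun t.coord (2 * m) (gr (embed σ)) = (2 : ℂ) ^ Multiset.card ρ.parts •
      MvPolynomial.expand 2 (MvPolynomial.psumPart (Fin t.rank) ℂ ρ) := by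
  have hsupp : σ.support = Finset.univ := by
    rw [← Finset.card_eq_iff_eq_univ, ← Equiv.Perm.sum_cycleType, hσ, Multiset.sum_map_mul_left,
      Multiset.map_id', ρ.parts_sum, Fintype.card_fin]
  have hparts : ρ.parts.map ((fun k => ∑ i, t.coord i ^ k) ∘ fun k => 2 * k) =
      ρ.parts.map fun k => 2 * MvPolynomial.expand 2 (MvPolynomial.psum (Fin t.rank) ℂ k) :=
    Multiset.map_congr rfl fun k hk => t.sum_coord_pow (ρ.parts_pos hk).ne'
  rw [charFun_gr_embed, sum_prod_ite_eq_prod_cycleType σ (fun p => by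
    rw [← Equiv.Perm.mem_support, hsupp]; exact Finset.mem_univ p), hσ, Multiset.map_map,
    hparts, Multiset.prod_map_mul, Multiset.map_const', Multiset.prod_replicate,
    MvPolynomial.psumPart, map_multiset_prod, Multiset.map_map, Algebra.smul_def, map_pow,
    map_ofNat]
  rfl

lemma gram_neg_comm (s : ℂ) (hs : ∀ i, t.eps (-i) = s * t.eps i) (i j : t.Idx) :
    gram t R j i = algebraMap ℂ R s * gram t R i j := by
  by_cases h : j = -i
  · subst h
    simp [gram, ClassicalType.Idx.neg_neg, hs]
  · have h' : ¬ i = -j := fun h' => h (by rw [h', ClassicalType.Idx.neg_neg])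
    simp [gram, h, h']

/-- The twist by `x` with `x_{-i} = -x_i` turns a symmetric form into an antisymmetric one and
conversely. This is why opposite idempotents stand on the two sides. -/
lemma gram_mul_neg_comm (s : ℂ) (hs : ∀ i, t.eps (-i) = s * t.eps i) {x : t.Idx → R}
    (hx : ∀ i, x (-i) = -x i) (i j : t.Idx) :
    gram t R j i * x j = -(algebraMap ℂ R s * (gram t R i j * x i)) := by
  rw [gram_neg_comm s hs i j]
  by_cases h : j = -i
  · subst h
    rw [hx]
    ring
  · simp [gram, h]

end CharFunValues

/-! ### Invariance of the characteristic function in the orthogonal and symplectic cases -/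

namespace ClassicalType

lemma eps_neg_so (N : ℕ) (i : (so N).Idx) : (so N).eps (-i) = 1 * (so N).eps i := by
  simp [eps]

lemma eps_neg_sp (M : ℕ) (i : (sp M).Idx) : (sp M).eps (-i) = -1 * (sp M).eps i := by
  simp [eps, Idx.coe_neg, Int.sign_neg]

end ClassicalType

-- The symmetric form on the right matches `h_+`; the antisymmetric twisted form on the left matches
-- `h_-`.
open ClassicalType in
lemma charFun_sandwich_so (N n : ℕ) (x : GR2 n) :
    charFun (so N).coord n (sandwich (hMinus n) (hPlus n) x) = charFun (so N).coord n x := by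
  rw [sandwich_apply, hMinus_eq_twistedSum, hPlus_eq_twistedSum, map_mul_twistedSum,
    map_twistedSum_mul]
  · refine charFun_gr_mul _ fun k hk c => pairProd_comp_of_antisymm (fun i j => ?_) c hk
    rw [gram_mul_neg_comm 1 (eps_neg_so N) (so N).coord_neg i j, map_one, one_mul]
  · refine charFun_mul_gr _ fun k hk c => ?_
    rw [pairProd_comp_of_symm (fun i j => ?_) c hk]
    · simp
    · rw [gram_neg_comm 1 (eps_neg_so N) i j, map_one, one_mul]

open ClassicalType in
lemma charFun_sandwich_sp (M n : ℕ) (x : GR2 n) :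
    charFun (sp M).coord n (sandwich (hPlus n) (hMinus n) x) = charFun (sp M).coord n x := by
  rw [sandwich_apply, hMinus_eq_twistedSum, hPlus_eq_twistedSum, map_mul_twistedSum,
    map_twistedSum_mul]
  · refine charFun_gr_mul _ fun k hk c => ?_
    rw [pairProd_comp_of_symm (fun i j => ?_) c hk]
    · simp
    · rw [gram_mul_neg_comm (-1) (eps_neg_sp M) (sp M).coord_neg i j, map_neg, map_one, neg_one_mul,
        neg_neg]
  · refine charFun_mul_gr _ fun k hk c => pairProd_comp_of_antisymm (fun i j => ?_) c hk
    rw [gram_neg_comm (-1) (eps_neg_sp M) i j, map_neg, map_one, neg_one_mul]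

/-! ### Detecting the leading term of an element of the enveloping algebra -/

section BaseChange

variable {K V V' : Type*} [CommRing K] [Algebra ℂ K] [AddCommGroup V] [Module ℂ V]
  [AddCommGroup V'] [Module ℂ V']

lemma baseChange_apply_eq_of_mem {f g : V →ₗ[ℂ] V'} {p : Submodule ℂ V} (h : ∀ y ∈ p, f y = g y)
    {z : K ⊗[ℂ] V} (hz : z ∈ p.baseChange K) : f.baseChange K z = g.baseChange K z := by
  rw [Submodule.baseChange_eq_span] at hz
  induction hz using Submodule.span_induction with
  | mem z hz =>
    obtain ⟨y, hy, rfl⟩ := hz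
    simp [h y hy]
  | zero => simp
  | add y z _ _ hy hz => rw [map_add, map_add, hy, hz]
  | smul c z _ hz => rw [map_smul, map_smul, hz]

end BaseChange

/-! ### Left invariant differential operators and symbols at the identity -/

namespace ClassicalType

variable (t : ClassicalType)

/-- The polynomial functions of an `N × N` matrix and of the parameters `x_1, …, x_M`. -/
abbrev MatFun : Type := MvPolynomial ((t.Idx × t.Idx) ⊕ Fin t.rank) ℂ

/-- The left invariant vector field on the space of matrices corresponding to a matrix `A`. -/
def vectorField (A : Matrix t.Idx t.Idx ℂ) : Derivation ℂ t.MatFun t.MatFun :=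
  MvPolynomial.mkDerivation ℂ
    (Sum.elim (fun q => ∑ k, A k q.2 • MvPolynomial.X (Sum.inl (q.1, k))) 0)

lemma vectorField_X_inl (A : Matrix t.Idx t.Idx ℂ) (q : t.Idx × t.Idx) :
    t.vectorField A (MvPolynomial.X (Sum.inl q)) =
      ∑ k, A k q.2 • (MvPolynomial.X (Sum.inl (q.1, k)) : t.MatFun) :=
  MvPolynomial.mkDerivation_X _ _ _

lemma vectorField_X_inr (A : Matrix t.Idx t.Idx ℂ) (k : Fin t.rank) :
    t.vectorField A (MvPolynomial.X (Sum.inr k)) = 0 :=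
  MvPolynomial.mkDerivation_X _ _ _

lemma vectorField_add (A B : Matrix t.Idx t.Idx ℂ) :
    t.vectorField (A + B) = t.vectorField A + t.vectorField B := by
  refine MvPolynomial.derivation_ext ?_
  rintro (q | k)
  · simp only [Derivation.add_apply, vectorField_X_inl, Matrix.add_apply, add_smul,
      Finset.sum_add_distrib]
  · simp only [Derivation.add_apply, vectorField_X_inr, add_zero]

lemma vectorField_smul (c : ℂ) (A : Matrix t.Idx t.Idx ℂ) :
    t.vectorField (c • A) = c • t.vectorField A := by
  refine MvPolynomial.derivation_ext ?_
  rintro (q | k)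
  · simp only [Derivation.smul_apply, vectorField_X_inl, Matrix.smul_apply, smul_eq_mul,
      mul_smul, Finset.smul_sum]
  · simp only [Derivation.smul_apply, vectorField_X_inr, smul_zero]

lemma vectorField_lie (A B : Matrix t.Idx t.Idx ℂ) :
    t.vectorField (A * B - B * A) = ⁅t.vectorField A, t.vectorField B⁆ := by
  refine MvPolynomial.derivation_ext ?_
  rintro (q | k)
  · simp only [Derivation.commutator_apply, vectorField_X_inl, map_sum, Derivation.map_smul,
      Matrix.sub_apply, Matrix.mul_apply, sub_smul, Finset.sum_sub_distrib, Finset.sum_smul,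
      Finset.smul_sum, smul_smul]
    congr 1 <;> rw [Finset.sum_comm] <;>
      exact Finset.sum_congr rfl fun _ _ => Finset.sum_congr rfl fun _ _ => by rw [mul_comm]
  · simp only [Derivation.commutator_apply, vectorField_X_inr, map_zero, sub_zero]

/-- The action of `𝔤` by left invariant vector fields. -/
def vectorFieldHom : t.lieAlg →ₗ⁅ℂ⁆ Module.End ℂ t.MatFun where
  toFun A := (t.vectorField A : t.MatFun →ₗ[ℂ] t.MatFun)
  map_add' A B := by
    rw [show ((A + B : t.lieAlg) : Matrix t.Idx t.Idx ℂ) = A + B from rfl, vectorField_add]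
    rfl
  map_smul' c A := by
    rw [show ((c • A : t.lieAlg) : Matrix t.Idx t.Idx ℂ) = c • A from rfl, vectorField_smul]
    rfl
  map_lie' {A B} := by
    rw [show ((⁅A, B⁆ : t.lieAlg) : Matrix t.Idx t.Idx ℂ) = A * B - B * A from rfl,
      vectorField_lie]
    exact Derivation.commutator_coe_linear_map

/-- The action of `U(𝔤)` by left invariant differential operators. -/
def diffOp : t.U →ₐ[ℂ] Module.End ℂ t.MatFun :=
  UniversalEnvelopingAlgebra.lift ℂ t.vectorFieldHom

lemma diffOp_mkAlgHom_ι (A : t.lieAlg) (y : t.MatFun) :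
    t.diffOp (UniversalEnvelopingAlgebra.mkAlgHom ℂ t.lieAlg (TensorAlgebra.ι ℂ A)) y =
      t.vectorField A y := by
  rw [diffOp, UniversalEnvelopingAlgebra.lift_ι_apply']
  rfl

/-- An affine function vanishing at the identity matrix, whose differential there is the generic
point of the Cartan subalgebra. -/
def genericFun : t.MatFun :=
  ∑ k, MvPolynomial.X (Sum.inr k) * (MvPolynomial.X (Sum.inl (t.negIdx k, t.negIdx k)) - 1)

/-- The evaluation at the identity matrix. -/
def evalOne : t.MatFun →ₐ[ℂ] MvPolynomial (Fin t.rank) ℂ :=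
  MvPolynomial.aeval (Sum.elim (fun q => if q.1 = q.2 then 1 else 0) MvPolynomial.X)

lemma evalOne_genericFun : t.evalOne t.genericFun = 0 := by
  simp [evalOne, genericFun]

lemma evalOne_vectorField_genericFun (A : t.lieAlg) :
    t.evalOne (t.vectorField A t.genericFun) = t.cartanProj A := by
  change _ = ∑ k : Fin t.rank, _
  rw [genericFun, map_sum, map_sum]
  refine Finset.sum_congr rfl fun k _ => ?_
  rw [Derivation.leibniz, vectorField_X_inr, smul_zero, add_zero, map_sub,
    Derivation.map_one_eq_zero, sub_zero, vectorField_X_inl]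
  simp [evalOne, Algebra.smul_def, mul_comm]

/-- The symbol of a product of vector fields at the differential of the generic function. -/
def symbol : TensorAlgebra ℂ t.lieAlg →ₐ[ℂ] t.MatFun :=
  TensorAlgebra.lift ℂ (LinearMap.applyₗ t.genericFun ∘ₗ t.vectorFieldHom.toLinearMap)

lemma symbol_ι (A : t.lieAlg) :
    t.symbol (TensorAlgebra.ι ℂ A) = t.vectorField A t.genericFun := by
  rw [symbol, TensorAlgebra.lift_ι_apply]
  rfl

lemma evalOne_symbol (a : TensorAlgebra ℂ t.lieAlg) :
    t.evalOne (t.symbol a) =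
      SymmetricAlgebra.lift t.cartanProj (SymmetricAlgebra.algHom ℂ t.lieAlg a) := by
  have : t.evalOne.comp t.symbol =
      (SymmetricAlgebra.lift t.cartanProj).comp (SymmetricAlgebra.algHom ℂ t.lieAlg) := by
    refine TensorAlgebra.hom_ext (LinearMap.ext fun A => ?_)
    change t.evalOne (t.symbol (TensorAlgebra.ι ℂ A)) =
      SymmetricAlgebra.lift t.cartanProj (SymmetricAlgebra.ι ℂ _ A)
    rw [symbol_ι, evalOne_vectorField_genericFun, SymmetricAlgebra.lift_ι_apply]
  exact congrArg (fun f : TensorAlgebra ℂ t.lieAlg →ₐ[ℂ] _ => f a) this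

/-- By the Leibniz rule each vector field lowers the power of `genericFun` by at most one. The
lowest power arises when every field differentiates a fresh factor; all other terms keep at least
one more factor of `genericFun`. -/
lemma exists_diffOp_genericFun_pow (n : ℕ) {k : ℕ} {a : TensorAlgebra ℂ t.lieAlg}
    (ha : a ∈ t.tensorPow k) (hk : k ≤ n) :
    ∃ b, t.diffOp (UniversalEnvelopingAlgebra.mkAlgHom ℂ t.lieAlg a) (t.genericFun ^ n) =
      (n.descFactorial k : ℂ) • (t.genericFun ^ (n - k) * t.symbol a) +
        t.genericFun ^ (n - k + 1) * b := by
  induction ha using Submodule.pow_induction_on_left' with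
  | algebraMap r =>
    refine ⟨0, ?_⟩
    simp [Algebra.smul_def, mul_comm]
  | add x y i hx hy ihx ihy =>
    obtain ⟨b, hb⟩ := ihx hk
    obtain ⟨c, hc⟩ := ihy hk
    refine ⟨b + c, ?_⟩
    rw [map_add, map_add, LinearMap.add_apply, hb, hc, map_add, mul_add, mul_add, smul_add]
    abel
  | mem_mul m hm i x hx ih =>
    obtain ⟨A, rfl⟩ := hm
    obtain ⟨b, hb⟩ := ih (by omega)
    obtain ⟨d, rfl⟩ : ∃ d, n = i + (d + 1) := ⟨n - i - 1, by omega⟩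
    have e1 : i + (d + 1) - i = d + 1 := by omega
    have e2 : i + (d + 1) - (i + 1) = d := by omega
    rw [e1] at hb
    -- The three terms arise when `A` differentiates the symbol, the power in front of the old
    -- remainder `b`, and `b` itself, after `genericFun ^ (d + 1)` is taken out.
    refine ⟨((i + (d + 1)).descFactorial i : ℂ) • t.vectorField A (t.symbol x) +
      ((d + 2 : ℕ) : t.MatFun) * (t.vectorField A t.genericFun * b) +
        t.genericFun * t.vectorField A b, ?_⟩
    rw [map_mul, map_mul, Module.End.mul_apply, hb, diffOp_mkAlgHom_ι, map_add,
      Derivation.map_smul, Derivation.leibniz, Derivation.leibniz, Derivation.leibniz_pow,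
      Derivation.leibniz_pow, map_mul, symbol_ι, Nat.succ_eq_add_one, e2, Nat.descFactorial_succ,
      e1]
    simp only [Nat.add_sub_cancel, smul_eq_mul, nsmul_eq_mul]
    simp only [Algebra.smul_def, map_natCast]
    push_cast
    ring

/-- The functional on `U(𝔤)` which detects the leading term in degree `n`. -/
def leadingFun (n : ℕ) : t.U →ₗ[ℂ] MvPolynomial (Fin t.rank) ℂ :=
  t.evalOne.toLinearMap ∘ₗ LinearMap.applyₗ (t.genericFun ^ n) ∘ₗ t.diffOp.toLinearMap

lemma leadingFun_apply (n : ℕ) (z : t.U) :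
    t.leadingFun n z = t.evalOne (t.diffOp z (t.genericFun ^ n)) := rfl

/-- At the identity `genericFun` vanishes, so only the term in which all `n` factors have been
differentiated survives, with coefficient `n!`. -/
lemma leadingFun_mkAlgHom {n : ℕ} {a : TensorAlgebra ℂ t.lieAlg} (ha : a ∈ t.tensorPow n) :
    t.leadingFun n (UniversalEnvelopingAlgebra.mkAlgHom ℂ t.lieAlg a) =
      (n.factorial : ℂ) •
        SymmetricAlgebra.lift t.cartanProj (SymmetricAlgebra.algHom ℂ t.lieAlg a) := by
  obtain ⟨b, hb⟩ := t.exists_diffOp_genericFun_pow n ha le_rfl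
  rw [leadingFun_apply, hb, ← evalOne_symbol]
  simp [evalOne_genericFun, Nat.descFactorial_self]

lemma range_ι_eq_map :
    LinearMap.range (UniversalEnvelopingAlgebra.ι ℂ : t.lieAlg →ₗ⁅ℂ⁆ t.U).toLinearMap =
      (LinearMap.range (TensorAlgebra.ι ℂ : t.lieAlg →ₗ[ℂ] TensorAlgebra ℂ t.lieAlg)).map
        (UniversalEnvelopingAlgebra.mkAlgHom ℂ t.lieAlg).toLinearMap := by
  rw [← LinearMap.range_comp]
  rfl

/-- Fewer than `n` differentiations leave a factor `genericFun`, which vanishes at the identity. -/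
lemma leadingFun_of_mem_filtLT {n : ℕ} {z : t.U} (hz : z ∈ t.filtLT n) :
    t.leadingFun n z = 0 := by
  refine (iSup₂_le (a := LinearMap.ker (t.leadingFun n)) fun k hk => ?_) hz
  rw [range_ι_eq_map, ← Submodule.map_pow]
  rintro _ ⟨a, ha, rfl⟩
  have hk := Finset.mem_range.1 hk
  obtain ⟨b, hb⟩ := t.exists_diffOp_genericFun_pow n ha hk.le
  rw [LinearMap.mem_ker, leadingFun_apply, AlgHom.toLinearMap_apply, hb]
  simp [evalOne_genericFun, (Nat.sub_pos_of_lt hk).ne']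

lemma IsLeadingPolynomial.baseChange_leadingFun {n : ℕ} {Z : Cu ⊗[ℂ] t.U}
    {f : Cu ⊗[ℂ] MvPolynomial (Fin t.rank) ℂ} (h : t.IsLeadingPolynomial n Z f) :
    (t.leadingFun n).baseChange Cu Z = (n.factorial : ℂ) • f := by
  obtain ⟨s, ⟨a, ha, rfl, hZ⟩, rfl⟩ := h
  have h1 := baseChange_apply_eq_of_mem (f := t.leadingFun n) (g := 0)
    (fun z hz => t.leadingFun_of_mem_filtLT hz) hZ
  rw [LinearMap.baseChange_zero, LinearMap.zero_apply, map_sub, sub_eq_zero] at h1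
  rw [h1]
  have h2 := baseChange_apply_eq_of_mem (K := Cu)
    (f := t.leadingFun n ∘ₗ (UniversalEnvelopingAlgebra.mkAlgHom ℂ t.lieAlg).toLinearMap)
    (g := (n.factorial : ℂ) • ((SymmetricAlgebra.lift t.cartanProj).toLinearMap ∘ₗ
      (SymmetricAlgebra.algHom ℂ t.lieAlg).toLinearMap))
    (fun z hz => t.leadingFun_mkAlgHom hz) ha
  rw [LinearMap.baseChange_smul, LinearMap.baseChange_comp, LinearMap.baseChange_comp] at h2
  exact h2

/-- The leading polynomial is unique. -/
lemma IsLeadingPolynomial.unique {n : ℕ} {Z : Cu ⊗[ℂ] t.U}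
    {f g : Cu ⊗[ℂ] MvPolynomial (Fin t.rank) ℂ} (hf : t.IsLeadingPolynomial n Z f)
    (hg : t.IsLeadingPolynomial n Z g) : f = g := by
  have h := (baseChange_leadingFun t hf).symm.trans (baseChange_leadingFun t hg)
  have hn : (n.factorial : ℂ) ≠ 0 := Nat.cast_ne_zero.2 n.factorial_ne_zero
  have := congrArg (fun z => (n.factorial : ℂ)⁻¹ • z) h
  simpa only [inv_smul_smul₀ hn] using this

end ClassicalType

/-! ### Traces of products of matrices in tensor factors -/

section ScaledTrace

variable {t : ClassicalType} {n : ℕ}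

lemma iota_apply {R : Type*} [Zero R] (p : Fin n) (X : Matrix t.Idx t.Idx R) (a b : Fin n → t.Idx) :
    iota t p X a b = if ∀ q, q ≠ p → a q = b q then X (a p) (b p) else 0 := rfl

variable {K C C' : Type*} [CommRing K] [Ring C] [Algebra K C] [Ring C'] [Algebra K C']

/-- The product of matrices acting in the tensor factors, alternating with scalar matrices. -/
def scaledProd (A : Fin n → Matrix (Fin n → t.Idx) (Fin n → t.Idx) K)
    (G : Fin n → Matrix t.Idx t.Idx C) (l : List (Fin n)) :
    Matrix (Fin n → t.Idx) (Fin n → t.Idx) C :=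
  (l.map fun p => (A p).map (algebraMap K C) * iota t p (G p)).prod

lemma scaledProd_cons (A : Fin n → Matrix (Fin n → t.Idx) (Fin n → t.Idx) K)
    (G : Fin n → Matrix t.Idx t.Idx C) (p : Fin n) (l : List (Fin n)) :
    scaledProd A G (p :: l) =
      (A p).map (algebraMap K C) * iota t p (G p) * scaledProd A G l := by
  rw [scaledProd, List.map_cons, List.prod_cons, scaledProd]

/-- The trace of a product of matrices acting in the tensor factors, alternating with scalar
matrices. -/
def scaledTrace (Y : Matrix (Fin n → t.Idx) (Fin n → t.Idx) K)
    (A : Fin n → Matrix (Fin n → t.Idx) (Fin n → t.Idx) K)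
    (G : Fin n → Matrix t.Idx t.Idx C) : C :=
  (Y.map (algebraMap K C) * scaledProd A G (List.finRange n)).trace

lemma iota_map (f : C →ₐ[K] C') (p : Fin n) (X : Matrix t.Idx t.Idx C) :
    (iota t p X).map f = iota t p (X.map f) := by
  ext a b
  simp only [Matrix.map_apply, iota_apply, apply_ite f, map_zero]

/-- One trace over the tensor algebra can thus be specialized both to `U(𝔤)` and to the polynomial
ring. -/
lemma map_scaledTrace (f : C →ₐ[K] C') (Y : Matrix (Fin n → t.Idx) (Fin n → t.Idx) K)
    (A : Fin n → Matrix (Fin n → t.Idx) (Fin n → t.Idx) K) (G : Fin n → Matrix t.Idx t.Idx C) :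
    f (scaledTrace Y A G) = scaledTrace Y A fun p => (G p).map f := by
  have hscal : ∀ B : Matrix (Fin n → t.Idx) (Fin n → t.Idx) K,
      f.mapMatrix (B.map (algebraMap K C)) = B.map (algebraMap K C') := by
    intro B
    ext a b
    simp
  have htr : ∀ B : Matrix (Fin n → t.Idx) (Fin n → t.Idx) C,
      f B.trace = (f.mapMatrix B).trace := by
    intro B
    simp [Matrix.trace]
  rw [scaledTrace, htr, map_mul, hscal, scaledProd, map_list_prod, List.map_map, scaledTrace,
    scaledProd]
  congr 4
  funext p
  rw [Function.comp_apply, map_mul, hscal, AlgHom.mapMatrix_apply, iota_map]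

lemma scalar_mul_mem (S : Submodule K C) (A : Matrix (Fin n → t.Idx) (Fin n → t.Idx) K)
    {M : Matrix (Fin n → t.Idx) (Fin n → t.Idx) C} (hM : ∀ a b, M a b ∈ S)
    (a b : Fin n → t.Idx) : (A.map (algebraMap K C) * M) a b ∈ S := by
  rw [Matrix.mul_apply]
  refine sum_mem fun c _ => ?_
  rw [Matrix.map_apply, ← Algebra.smul_def]
  exact S.smul_mem _ (hM c b)

lemma mul_mem_of_mem {S S' S'' : Submodule K C} (hS : ∀ x ∈ S, ∀ y ∈ S', x * y ∈ S'')
    {M M' : Matrix (Fin n → t.Idx) (Fin n → t.Idx) C} (hM : ∀ a b, M a b ∈ S)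
    (hM' : ∀ a b, M' a b ∈ S') (a b : Fin n → t.Idx) : (M * M') a b ∈ S'' := by
  rw [Matrix.mul_apply]
  exact sum_mem fun c _ => hS _ (hM a c) _ (hM' c b)

lemma iota_mem (S : Submodule K C) {X : Matrix t.Idx t.Idx C} (hX : ∀ i j, X i j ∈ S) (p : Fin n)
    (a b : Fin n → t.Idx) : iota t p X a b ∈ S := by
  rw [iota_apply]
  split_ifs
  · exact hX _ _
  · exact zero_mem _

/-- The product belongs to the term of a multiplicative family of subspaces numbered by the number
of factors. -/
lemma scaledProd_mem {S : ℕ → Submodule K C} (h1 : 1 ∈ S 0)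
    (hS : ∀ k, ∀ x ∈ S 1, ∀ y ∈ S k, x * y ∈ S (k + 1))
    (A : Fin n → Matrix (Fin n → t.Idx) (Fin n → t.Idx) K) {G : Fin n → Matrix t.Idx t.Idx C}
    (hG : ∀ p i j, G p i j ∈ S 1) (l : List (Fin n)) (a b : Fin n → t.Idx) :
    scaledProd A G l a b ∈ S l.length := by
  induction l generalizing a b with
  | nil =>
    rw [scaledProd, List.map_nil, List.prod_nil, Matrix.one_apply]
    split_ifs
    · exact h1
    · exact zero_mem _
  | cons p l ih =>
    rw [scaledProd_cons, List.length_cons, mul_assoc]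
    exact scalar_mul_mem _ _ (mul_mem_of_mem (hS _) (iota_mem _ (hG p) p) ih) a b

/-- A change of the matrices by scalars changes the product by terms of lower degree. -/
lemma scaledProd_sub_mem {S L : ℕ → Submodule K C} (h1 : 1 ∈ S 0)
    (hS : ∀ k, ∀ x ∈ S 1, ∀ y ∈ S k, x * y ∈ S (k + 1))
    (hL : ∀ k, ∀ x ∈ S 1, ∀ y ∈ L k, x * y ∈ L (k + 1)) (hLL : ∀ k, L k ≤ L (k + 1))
    (hSL : ∀ k, S k ≤ L (k + 1))
    (A : Fin n → Matrix (Fin n → t.Idx) (Fin n → t.Idx) K) {G : Fin n → Matrix t.Idx t.Idx C}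
    (hG : ∀ p i j, G p i j ∈ S 1) (c : Fin n → Matrix t.Idx t.Idx K) (l : List (Fin n))
    (a b : Fin n → t.Idx) :
    (scaledProd A (fun p => G p - (c p).map (algebraMap K C)) l - scaledProd A G l) a b ∈
      L l.length := by
  induction l generalizing a b with
  | nil => simp [scaledProd]
  | cons p l ih =>
    have hiota : iota t p (G p - (c p).map (algebraMap K C)) =
        iota t p (G p) - (iota t p (c p)).map (algebraMap K C) := by
      ext a b
      simp only [iota_apply, Matrix.sub_apply, Matrix.map_apply]
      split_ifs <;> simp
    set P' := scaledProd A (fun p => G p - (c p).map (algebraMap K C)) l with hP'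
    set P := scaledProd A G l with hP
    -- The difference splits into a matrix of degree one times the old difference, and a scalar
    -- matrix times the perturbed product `P' = P + (P' - P)`; both have degree below the new number
    -- of factors.
    have e : scaledProd A (fun p => G p - (c p).map (algebraMap K C)) (p :: l) -
        scaledProd A G (p :: l) = (A p).map (algebraMap K C) * (iota t p (G p) * (P' - P) -
          (iota t p (c p)).map (algebraMap K C) * (P + (P' - P))) := by
      rw [scaledProd_cons, scaledProd_cons, hiota, add_sub_cancel, ← hP, ← hP']
      clear_value P P'
      noncomm_ring
    rw [e, List.length_cons]
    refine scalar_mul_mem _ _ (fun a b => ?_) a b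
    rw [Matrix.sub_apply]
    refine sub_mem (mul_mem_of_mem (hL _) (iota_mem _ (hG p) p) ih a b)
      (scalar_mul_mem _ _ (fun a b => ?_) a b)
    rw [Matrix.add_apply]
    exact add_mem (hSL _ (scaledProd_mem h1 hS A hG l a b)) (hLL _ (ih a b))

end ScaledTrace

/-! ### Filtrations over `ℂ(u)` and the leading polynomial of a trace -/

section BaseChangePow

variable {K B : Type*} [CommRing K] [Algebra ℂ K] [Ring B] [Algebra ℂ B]

lemma mul_mem_baseChange {p q r : Submodule ℂ B} (h : ∀ x ∈ p, ∀ y ∈ q, x * y ∈ r)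
    {x y : K ⊗[ℂ] B} (hx : x ∈ p.baseChange K) (hy : y ∈ q.baseChange K) :
    x * y ∈ r.baseChange K := by
  rw [Submodule.baseChange_eq_span] at hx hy
  induction hx using Submodule.span_induction with
  | mem x hx =>
    obtain ⟨x, hx, rfl⟩ := hx
    induction hy using Submodule.span_induction with
    | mem y hy =>
      obtain ⟨y, hy, rfl⟩ := hy
      simpa using Submodule.tmul_mem_baseChange_of_mem (1 : K) (h x hx y hy)
    | zero => rw [mul_zero]; exact zero_mem _
    | add y z _ _ hy hz => rw [mul_add]; exact add_mem hy hz
    | smul c y _ hy => rw [mul_smul_comm]; exact Submodule.smul_mem _ _ hy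
  | zero => rw [zero_mul]; exact zero_mem _
  | add x z _ _ hx hz => rw [add_mul]; exact add_mem hx hz
  | smul c x _ hx => rw [smul_mul_assoc]; exact Submodule.smul_mem _ _ hx

end BaseChangePow

namespace ClassicalType

variable (t : ClassicalType)

/-- The leading part of the matrix `F(v)`. -/
def genMatrix : Matrix t.Idx t.Idx (Cu ⊗[ℂ] TensorAlgebra ℂ t.lieAlg) :=
  Matrix.of fun i j => 1 ⊗ₜ[ℂ] TensorAlgebra.ι ℂ (t.F j i)

lemma tensorPow_mul_mem (k : ℕ) : ∀ x ∈ t.tensorPow 1, ∀ y ∈ t.tensorPow k,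
    x * y ∈ t.tensorPow (k + 1) := by
  intro x hx y hy
  rw [tensorPow, pow_one] at hx
  rw [tensorPow, pow_succ']
  exact Submodule.mul_mem_mul hx hy

/-- The subspace of `U(𝔤)` spanned by the products of `n` elements of `𝔤`. -/
def envPow (n : ℕ) : Submodule ℂ t.U :=
  (LinearMap.range (UniversalEnvelopingAlgebra.ι ℂ : t.lieAlg →ₗ⁅ℂ⁆ t.U).toLinearMap) ^ n

lemma envPow_mul_mem (k : ℕ) : ∀ x ∈ t.envPow 1, ∀ y ∈ t.envPow k,
    x * y ∈ t.envPow (k + 1) := by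
  intro x hx y hy
  rw [envPow, pow_one] at hx
  rw [envPow, pow_succ']
  exact Submodule.mul_mem_mul hx hy

lemma envPow_le_filtLT {k n : ℕ} (h : k < n) : t.envPow k ≤ t.filtLT n :=
  le_iSup₂_of_le k (Finset.mem_range.2 h) le_rfl

lemma filtLT_mono {k n : ℕ} (h : k ≤ n) : t.filtLT k ≤ t.filtLT n :=
  iSup₂_le fun _ hj => t.envPow_le_filtLT ((Finset.mem_range.1 hj).trans_le h)

lemma envPow_mul_mem_filtLT (k : ℕ) : ∀ x ∈ t.envPow 1, ∀ y ∈ t.filtLT k,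
    x * y ∈ t.filtLT (k + 1) := by
  intro x hx y hy
  refine (iSup₂_le (a := (t.filtLT (k + 1)).comap (LinearMap.mulLeft ℂ x)) fun j hj => ?_) hy
  intro z hz
  exact t.envPow_le_filtLT (Nat.succ_lt_succ (Finset.mem_range.1 hj))
    (t.envPow_mul_mem j x hx z hz)

variable {t} {n : ℕ}

/-- The leading polynomial of a trace of a product of the matrices `F(v)`. -/
lemma isLeadingPolynomial_scaledTrace (Y : Matrix (Fin n → t.Idx) (Fin n → t.Idx) Cu)
    (A : Fin n → Matrix (Fin n → t.Idx) (Fin n → t.Idx) Cu) (v : Fin n → Cu) :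
    t.IsLeadingPolynomial n (scaledTrace Y A fun p => Fv t (v p))
      (scaledTrace Y A fun _ => Matrix.diagonal fun i => 1 ⊗ₜ[ℂ] t.coord i) := by
  have hlen : (List.finRange n).length = n := List.length_finRange
  -- The representative in `T^n(𝔤)` is the same trace with the scalar part of every `F(v)`
  -- discarded.
  refine ⟨_, ⟨scaledTrace Y A fun _ => t.genMatrix, ?_, rfl, ?_⟩, ?_⟩
  · have h := scaledProd_mem (S := fun k => (t.tensorPow k).baseChange Cu)
      (Submodule.tmul_mem_baseChange_of_mem 1 (by
        rw [tensorPow, pow_zero]; exact Submodule.one_le.1 le_rfl))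
      (fun k x hx y hy => mul_mem_baseChange (t.tensorPow_mul_mem k) hx hy) A
      (G := fun _ => t.genMatrix) (fun p i j => Submodule.tmul_mem_baseChange_of_mem 1 (by
        rw [tensorPow, pow_one]; exact ⟨_, rfl⟩)) (List.finRange n)
    simp only [hlen] at h
    exact sum_mem fun a _ => scalar_mul_mem _ _ h a a
  · let f : Cu ⊗[ℂ] TensorAlgebra ℂ t.lieAlg →ₐ[Cu] Cu ⊗[ℂ] t.U :=
      Algebra.TensorProduct.map (AlgHom.id Cu Cu) (UniversalEnvelopingAlgebra.mkAlgHom ℂ t.lieAlg)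
    have hf : (UniversalEnvelopingAlgebra.mkAlgHom ℂ t.lieAlg).toLinearMap.baseChange Cu
        (scaledTrace Y A fun _ => t.genMatrix) = f (scaledTrace Y A fun _ => t.genMatrix) := rfl
    have hFv : ∀ p, Fv t (v p) = t.genMatrix.map f -
        (Matrix.diagonal fun _ => v p + algebraMap ℂ Cu t.eta).map (algebraMap Cu (Cu ⊗[ℂ] t.U)) := by
      intro p
      ext i j
      simp only [Fv, genMatrix, Matrix.of_apply, Matrix.sub_apply, Matrix.map_apply,
        Matrix.diagonal_apply]
      congr 1
      split_ifs
      · rfl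
      · rw [map_zero]
    rw [hf, map_scaledTrace]
    simp only [hFv]
    have h := scaledProd_sub_mem (S := fun k => (t.envPow k).baseChange Cu)
      (L := fun k => (t.filtLT k).baseChange Cu)
      (Submodule.tmul_mem_baseChange_of_mem 1 (by
        rw [envPow, pow_zero]; exact Submodule.one_le.1 le_rfl))
      (fun k x hx y hy => mul_mem_baseChange (t.envPow_mul_mem k) hx hy)
      (fun k x hx y hy => mul_mem_baseChange (t.envPow_mul_mem_filtLT k) hx hy)
      (fun k => Submodule.baseChange_mono Cu (t.filtLT_mono k.le_succ))
      (fun k => Submodule.baseChange_mono Cu (t.envPow_le_filtLT k.lt_succ_self)) A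
      (G := fun _ => t.genMatrix.map f) (fun p i j => Submodule.tmul_mem_baseChange_of_mem 1 (by
        rw [envPow, pow_one]; exact ⟨_, rfl⟩))
      (fun p => Matrix.diagonal fun _ => v p + algebraMap ℂ Cu t.eta) (List.finRange n)
    simp only [hlen] at h
    rw [scaledTrace, scaledTrace, ← Matrix.trace_sub, ← mul_sub]
    exact sum_mem fun a _ => scalar_mul_mem _ _ h a a
  · let f : Cu ⊗[ℂ] TensorAlgebra ℂ t.lieAlg →ₐ[Cu] Cu ⊗[ℂ] MvPolynomial (Fin t.rank) ℂ :=
      Algebra.TensorProduct.map (AlgHom.id Cu Cu)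
        ((SymmetricAlgebra.lift t.cartanProj).comp (SymmetricAlgebra.algHom ℂ t.lieAlg))
    have hf : (SymmetricAlgebra.lift t.cartanProj).toLinearMap.baseChange Cu
        ((SymmetricAlgebra.algHom ℂ t.lieAlg).toLinearMap.baseChange Cu
          (scaledTrace Y A fun _ => t.genMatrix)) = f (scaledTrace Y A fun _ => t.genMatrix) := by
      rw [← LinearMap.comp_apply, ← LinearMap.baseChange_comp]
      rfl
    rw [hf, map_scaledTrace]
    congr 1
    funext _
    ext i j
    have h : SymmetricAlgebra.lift t.cartanProj (SymmetricAlgebra.algHom ℂ t.lieAlg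
        (TensorAlgebra.ι ℂ (t.F j i))) = t.cartanProj (t.F j i) :=
      SymmetricAlgebra.lift_ι_apply t.cartanProj (t.F j i)
    rw [Matrix.map_apply, genMatrix, Matrix.of_apply, Algebra.TensorProduct.map_tmul,
      AlgHom.comp_apply, h, cartanProj_F, Matrix.diagonal_apply, map_one]
    by_cases hij : i = j
    · subst hij
      simp
    · rw [if_neg hij, if_neg (Ne.symm hij), TensorProduct.tmul_zero]

end ClassicalType

/-- The element `Z_ν(u)` as a trace of a product alternating with scalar matrices. -/
lemma Zfun_eq_scaledTrace (t : ClassicalType) {n : ℕ} {ν : YoungDiagram} (T : StandardTableau ν n)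
    (Φ : GroupRing (Fin n)) :
    Zfun t T Φ = scaledTrace ((groupRingOp t Φ).map (algebraMap ℂ Cu))
      (fun p => 1 + ((2 * RatFunc.X + (T.content p : Cu))⁻¹ : Cu) •
        (∑ q : Fin n with q < p, Qop t q p).map (algebraMap ℂ Cu))
      (fun p => Fv t (RatFunc.X + (T.content p : Cu))) := by
  have hmap : ∀ B : Matrix (Fin n → t.Idx) (Fin n → t.Idx) ℂ,
      (B.map (algebraMap ℂ Cu)).map (algebraMap Cu (Uu t)) = liftOp t B := by
    intro B
    ext a b
    rfl
  rw [Zfun, FT, scaledTrace, hmap, scaledProd, List.ofFn_eq_map]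
  congr 4
  funext p
  congr 1
  rw [← hmap]
  ext a b
  simp only [Matrix.map_apply, Matrix.add_apply, Matrix.smul_apply, Matrix.one_apply, map_add,
    smul_eq_mul, map_mul, apply_ite (algebraMap Cu (Uu t)), map_one, map_zero]
  rw [Algebra.smul_def]

/-! ### Operators in tensor factors -/

section Iota

variable {t : ClassicalType} {n : ℕ} {R : Type*} [CommRing R]

lemma iota_mul_apply (p : Fin n) (A : Matrix t.Idx t.Idx R)
    (Y : Matrix (Fin n → t.Idx) (Fin n → t.Idx) R) (a b : Fin n → t.Idx) :
    (iota t p A * Y) a b = ∑ k, A (a p) k * Y (Function.update a p k) b := by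
  rw [Matrix.mul_apply]
  symm
  refine Fintype.sum_of_injective (Function.update a p) (Function.update_injective a p) _ _ ?_ ?_
  · intro c hc
    rw [iota_apply, if_neg, zero_mul]
    intro h
    refine hc ⟨c p, funext fun q => ?_⟩
    by_cases hq : q = p
    · subst hq; simp
    · rw [Function.update_of_ne hq, h q hq]
  · intro k
    rw [iota_apply, if_pos (fun q hq => by rw [Function.update_of_ne hq]), Function.update_self]

lemma mul_iota_apply (p : Fin n) (A : Matrix t.Idx t.Idx R)
    (Y : Matrix (Fin n → t.Idx) (Fin n → t.Idx) R) (a b : Fin n → t.Idx) :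
    (Y * iota t p A) a b = ∑ k, Y a (Function.update b p k) * A k (b p) := by
  rw [Matrix.mul_apply]
  symm
  refine Fintype.sum_of_injective (Function.update b p) (Function.update_injective b p) _ _ ?_ ?_
  · intro c hc
    rw [iota_apply, if_neg, mul_zero]
    intro h
    refine hc ⟨c p, funext fun q => ?_⟩
    by_cases hq : q = p
    · subst hq; simp
    · rw [Function.update_of_ne hq, h q hq]
  · intro k
    rw [iota_apply, if_pos (fun q hq => by rw [Function.update_of_ne hq]), Function.update_self]

lemma iota_commute {p q : Fin n} (hpq : p ≠ q) (A B : Matrix t.Idx t.Idx R) :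
    Commute (iota t p A) (iota t q B) := by
  ext a b
  rw [iota_mul_apply, mul_iota_apply, Finset.sum_eq_single (b p), Finset.sum_eq_single (a p)]
  · rw [iota_apply, iota_apply, Function.update_of_ne hpq.symm, Function.update_of_ne hpq.symm]
    have : (∀ r, r ≠ q → Function.update a p (b p) r = b r) ↔
        ∀ r, r ≠ q → a r = Function.update b p (a p) r := by
      refine forall_congr' fun r => forall_congr' fun _ => ?_
      by_cases hr : r = p
      · subst hr; simp
      · rw [Function.update_of_ne hr, Function.update_of_ne hr]
    simp only [this]
    split_ifs
    · rw [mul_comm]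
    · simp
  · intro k _ hk
    rw [iota_apply, if_neg, zero_mul]
    intro h
    have := h p hpq
    rw [Function.update_self] at this
    exact hk this.symm
  · simp
  · intro k _ hk
    rw [iota_apply, if_neg, mul_zero]
    intro h
    have := h p hpq
    rw [Function.update_self] at this
    exact hk this
  · simp

lemma iota_diagonal (p : Fin n) (x : t.Idx → R) :
    iota t p (Matrix.diagonal x) = Matrix.diagonal fun a => x (a p) := by
  ext a b
  rw [iota_apply, Matrix.diagonal_apply, Matrix.diagonal_apply]
  by_cases h : a = b
  · subst h; simp
  · rw [if_neg h]
    split_ifs with h1 h2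
    · refine absurd (funext fun q => ?_) h
      by_cases hq : q = p
      · rw [hq, h2]
      · exact h1 q hq
    · rfl
    · rfl

lemma prod_iota_diagonal (x : t.Idx → R) :
    ((List.finRange n).map fun p => iota t p (Matrix.diagonal x)).prod =
      Matrix.diagonal fun a => ∏ p, x (a p) := by
  have h : ((List.finRange n).map fun p : Fin n => iota t p (Matrix.diagonal x)) =
      ((List.finRange n).map fun (p : Fin n) (a : Fin n → t.Idx) => x (a p)).map
        (Matrix.diagonalRingHom (Fin n → t.Idx) R) := by
    rw [List.map_map]
    refine List.map_congr_left fun p _ => ?_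
    rw [iota_diagonal]
    rfl
  rw [h, ← map_list_prod, ← List.ofFn_eq_map, List.prod_ofFn]
  change Matrix.diagonal _ = _
  congr 1
  funext a
  rw [Finset.prod_apply]

variable [Algebra ℂ R]

/-- The operator `Q_{qp}` with entries in `R`. -/
lemma Qop_map (q p : Fin n) : (Qop t q p).map (algebraMap ℂ R) =
    ∑ i : t.Idx, ∑ j : t.Idx, algebraMap ℂ R (t.eps i * t.eps j) •
      (iota t q (Matrix.single i j (1 : R)) * iota t p (Matrix.single (-i) (-j) 1)) := by
  have hiota : ∀ (p : Fin n) (i j : t.Idx),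
      (algebraMap ℂ R).mapMatrix (iota t p (Matrix.single i j 1)) =
        iota t p (Matrix.single i j (1 : R)) := by
    intro p i j
    ext a b
    simp only [RingHom.mapMatrix_apply, Matrix.map_apply, iota_apply, Matrix.single_apply,
      apply_ite (algebraMap ℂ R), map_one, map_zero]
  change (algebraMap ℂ R).mapMatrix (Qop t q p) = _
  rw [Qop, map_sum]
  refine Finset.sum_congr rfl fun i _ => ?_
  rw [map_sum]
  refine Finset.sum_congr rfl fun j _ => ?_
  rw [← hiota, ← hiota, ← map_mul]
  ext a b
  rw [RingHom.mapMatrix_apply, Matrix.map_apply, Matrix.smul_apply, smul_eq_mul, map_mul,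
    Matrix.smul_apply, RingHom.mapMatrix_apply, Matrix.map_apply, smul_eq_mul]

/-- The partial transpose of the action of `Q_{qp}` by multiplication. -/
def swapOp (q p : Fin n) (Y : Matrix (Fin n → t.Idx) (Fin n → t.Idx) R) :
    Matrix (Fin n → t.Idx) (Fin n → t.Idx) R :=
  ∑ i : t.Idx, ∑ j : t.Idx, algebraMap ℂ R (t.eps i * t.eps j) •
      (iota t q (Matrix.single i j (1 : R)) * Y * iota t p (Matrix.single (-i) (-j) 1))

lemma swapOp_apply (q p : Fin n) (Y : Matrix (Fin n → t.Idx) (Fin n → t.Idx) R)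
    (a b : Fin n → t.Idx) : swapOp q p Y a b =
      algebraMap ℂ R (t.eps (a q) * t.eps (-b p)) *
        Y (Function.update a q (-b p)) (Function.update b p (-a q)) := by
  have h : ∀ i j : t.Idx, (iota t q (Matrix.single i j (1 : R)) * Y *
      iota t p (Matrix.single (-i) (-j) 1) :
        Matrix (Fin n → t.Idx) (Fin n → t.Idx) R) a b =
      if i = a q ∧ j = -b p then Y (Function.update a q j) (Function.update b p (-i)) else 0 := by
    intro i j
    rw [mul_iota_apply, Finset.sum_eq_single (-i), iota_mul_apply, Finset.sum_eq_single j]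
    · have : -j = b p ↔ j = -b p := ⟨fun h => by rw [← h, ClassicalType.Idx.neg_neg],
        fun h => by rw [h, ClassicalType.Idx.neg_neg]⟩
      by_cases h1 : i = a q <;> by_cases h2 : j = -b p <;>
        simp [h1, h2, this, ClassicalType.Idx.neg_neg]
    · intro k _ hk
      simp [hk.symm]
    · simp
    · intro k _ hk
      simp [hk.symm]
    · simp
  rw [swapOp, Matrix.sum_apply, Finset.sum_eq_single (a q), Matrix.sum_apply,
    Finset.sum_eq_single (-b p), Matrix.smul_apply, h, if_pos ⟨rfl, rfl⟩, smul_eq_mul]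
  · intro j _ hj
    rw [Matrix.smul_apply, h, if_neg (fun h => hj h.2), smul_zero]
  · simp
  · intro i _ hi
    rw [Matrix.sum_apply]
    refine Finset.sum_eq_zero fun j _ => ?_
    rw [Matrix.smul_apply, h, if_neg (fun h => hi h.1), smul_zero]
  · simp

/-- The trace form of the partial transposition. -/
lemma trace_mul_swapOp {q p : Fin n} (hqp : q ≠ p)
    {D X Y : Matrix (Fin n → t.Idx) (Fin n → t.Idx) R}
    (hD : ∀ B, Commute D (iota t p B)) (hX : ∀ B, Commute X (iota t q B)) :
    (D * X * swapOp q p Y).trace = (D * (Qop t q p).map (algebraMap ℂ R) * X * Y).trace := by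
  rw [swapOp, Qop_map]
  simp only [Finset.mul_sum, Finset.sum_mul, Matrix.trace_sum, mul_smul_comm, smul_mul_assoc,
    Matrix.trace_smul]
  refine Finset.sum_congr rfl fun i _ => Finset.sum_congr rfl fun j _ => ?_
  congr 1
  -- Cyclicity brings the unit in factor `p` to the front, where it passes `D`; the unit in factor
  -- `q` passes `X` to the left, and the two recombine into `Q_{qp}`.
  rw [← mul_assoc, Matrix.trace_mul_comm, (iota_commute hqp _ _).eq, ← mul_assoc, ← mul_assoc,
    ← mul_assoc, ← mul_assoc, ← (hD _).eq, mul_assoc _ X, (hX _).eq, ← mul_assoc]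

end Iota

/-! ### The tensors corresponding to operators -/

section ToVec

variable {t : ClassicalType} {n : ℕ} {R : Type*} [CommRing R] [Algebra ℂ R]

/-- The tensor in `(R^N)^{⊗ 2n}` corresponding to an operator in `(R^N)^{⊗ n}`. -/
def toVec (Y : Matrix (Fin n → t.Idx) (Fin n → t.Idx) R) : Vec t n R := fun c =>
  (∏ p, algebraMap ℂ R (t.eps (-c (Sum.inr p)))) *
    Y (fun p => c (Sum.inl p)) (fun p => -c (Sum.inr p))

lemma toVec_add (Y Z : Matrix (Fin n → t.Idx) (Fin n → t.Idx) R) :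
    toVec (Y + Z) = toVec Y + toVec Z := by
  funext c
  simp [toVec, mul_add]

lemma toVec_smul {K : Type*} [CommRing K] [Algebra K R] (k : K)
    (Y : Matrix (Fin n → t.Idx) (Fin n → t.Idx) R) : toVec (k • Y) = k • toVec Y := by
  funext c
  simp [toVec]

lemma toVec_sum {ι : Type*} (s : Finset ι) (Y : ι → Matrix (Fin n → t.Idx) (Fin n → t.Idx) R) :
    toVec (∑ i ∈ s, Y i) = ∑ i ∈ s, toVec (Y i) := by
  funext c
  simp [toVec, Finset.mul_sum, Matrix.sum_apply]

/-- The signs built into `toVec` are those of the form, so they square to `1` in the pairing. -/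
lemma pairing_toVec {K : Type*} [CommRing K] [Algebra K R] (x : t.Idx → R)
    (Y : Matrix (Fin n → t.Idx) (Fin n → t.Idx) R) :
    pairing K x n (toVec Y) = (Matrix.diagonal (fun a : Fin n → t.Idx => ∏ p, x (a p)) * Y).trace := by
  rw [pairing_eq_sum, Matrix.trace]
  refine Finset.sum_congr rfl fun a _ => ?_
  rw [Matrix.diag_apply, Matrix.diagonal_mul, toVec]
  simp only [Sum.elim_inl, Sum.elim_inr, ClassicalType.Idx.neg_neg]
  rw [Finset.prod_mul_distrib, mul_mul_mul_comm, ← mul_assoc, ← Finset.prod_mul_distrib]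
  simp only [← map_mul, t.eps_mul_self]
  simp

/-- The invariant tensor corresponds to the identity operator, and `S_n` moves only the output
indices of an operator. -/
lemma vecRep_embed_formVec {K : Type*} [CommRing K] [Algebra K R] (σ : Equiv.Perm (Fin n)) :
    vecRep t n K R (embed σ) (formVec t n R) = toVec ((permOp t σ).map (algebraMap ℂ R)) := by
  funext c
  rw [vecRep_apply, formVec, pairProd, toVec, Matrix.map_apply, permOp, Matrix.of_apply]
  simp only [Function.comp_apply, embed, Equiv.Perm.sumCongr_apply, Sum.map_inl, Sum.map_inr,
    Equiv.Perm.coe_one, id_eq, gram]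
  by_cases h : ∀ p, c (Sum.inl (σ p)) = -c (Sum.inr p)
  · simp [h, ClassicalType.Idx.neg_neg]
  · rw [if_neg h, map_zero, mul_zero]
    push Not at h
    obtain ⟨p, hp⟩ := h
    refine Finset.prod_eq_zero (Finset.mem_univ p) (if_neg fun h => hp ?_)
    rw [h, ClassicalType.Idx.neg_neg]

/-- Exchanging output index `q` with input index `p` is, up to the signs of the form, multiplying by
the two halves of `Q_{qp}` on opposite sides. This is where the symmetric group action and the
operators `Q` meet. -/
lemma vecRep_swap_toVec {K : Type*} [CommRing K] [Algebra K R] (q p : Fin n)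
    (Y : Matrix (Fin n → t.Idx) (Fin n → t.Idx) R) :
    vecRep t n K R (Equiv.swap (Sum.inl q) (Sum.inr p)) (toVec Y) = toVec (swapOp q p Y) := by
  funext c
  rw [vecRep_apply, toVec, toVec, swapOp_apply, ← mul_assoc]
  set s : Equiv.Perm (Fin n ⊕ Fin n) := Equiv.swap (Sum.inl q) (Sum.inr p) with hs
  have h1 : ∀ r, r ≠ q → s (Sum.inl r) = Sum.inl r := fun r hr =>
    Equiv.swap_apply_of_ne_of_ne (by simpa using hr) (by simp)
  have h2 : ∀ r, r ≠ p → s (Sum.inr r) = Sum.inr r := fun r hr =>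
    Equiv.swap_apply_of_ne_of_ne (by simp) (by simpa using hr)
  have h3 : s (Sum.inl q) = Sum.inr p := Equiv.swap_apply_left _ _
  have h4 : s (Sum.inr p) = Sum.inl q := Equiv.swap_apply_right _ _
  congr 1
  · rw [← Finset.mul_prod_erase _ _ (Finset.mem_univ p),
      ← Finset.mul_prod_erase Finset.univ (fun r => algebraMap ℂ R (t.eps (-c (Sum.inr r))))
        (Finset.mem_univ p), Finset.prod_congr rfl (fun r hr => by
        rw [Function.comp_apply, h2 r (Finset.ne_of_mem_erase hr)]), mul_right_comm]
    congr 1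
    rw [Function.comp_apply, h4, ← map_mul]
    congr 1
    rw [ClassicalType.Idx.neg_neg, mul_comm (t.eps (c (Sum.inl q))), ← mul_assoc,
      mul_comm (t.eps (-c (Sum.inr p))), ← t.eps_mul_eps_neg (c (Sum.inl q)), mul_right_comm,
      t.eps_mul_self, one_mul]
  · congr 1
    · funext r
      by_cases hr : r = q
      · subst hr
        rw [Function.update_self, Function.comp_apply, h3, ClassicalType.Idx.neg_neg]
      · rw [Function.update_of_ne hr, Function.comp_apply, h1 r hr]
    · funext r
      by_cases hr : r = p
      · subst hr
        rw [Function.update_self, Function.comp_apply, h4]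
      · rw [Function.update_of_ne hr, Function.comp_apply, h2 r hr]

end ToVec

/-! ### The trace identity -/

section TraceIdentity

variable {t : ClassicalType} {n : ℕ} {R K : Type*} [CommRing R] [Algebra ℂ R] [CommRing K]
  [Algebra ℂ K] [Algebra K R] [IsScalarTower ℂ K R]

/-- The scalar matrix `1 + κ_p (Q_{1p} + ⋯ + Q_{p-1,p})`. -/
def brauerFactor (t : ClassicalType) (κ : Fin n → K) (p : Fin n) :
    Matrix (Fin n → t.Idx) (Fin n → t.Idx) K :=
  1 + κ p • (∑ q : Fin n with q < p, Qop t q p).map (algebraMap ℂ K)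

/-- The partial transpose of a product of the factors `1 + κ_p (Q_{1p} + ⋯ + Q_{p-1,p})`. -/
def transposedProd (κ : Fin n → K) (Y : Matrix (Fin n → t.Idx) (Fin n → t.Idx) R)
    (l : List (Fin n)) : Matrix (Fin n → t.Idx) (Fin n → t.Idx) R :=
  l.foldr (fun p Z => Z + κ p • ∑ q : Fin n with q < p, swapOp q p Z) Y

lemma brauerFactor_map (κ : Fin n → K) (p : Fin n) :
    (brauerFactor t κ p).map (algebraMap K R) =
      1 + κ p • ∑ q : Fin n with q < p, (Qop t q p).map (algebraMap ℂ R) := by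
  ext a b
  simp only [brauerFactor, Matrix.map_apply, Matrix.add_apply, Matrix.smul_apply, Matrix.one_apply,
    map_add, smul_eq_mul, map_mul, apply_ite (algebraMap K R), map_one, map_zero,
    Matrix.sum_apply, map_sum, ← IsScalarTower.algebraMap_apply ℂ K R]
  rw [Algebra.smul_def]

lemma Qop_map_commute {q p r : Fin n} (hq : q ≠ r) (hp : p ≠ r) (B : Matrix t.Idx t.Idx R) :
    Commute ((Qop t q p).map (algebraMap ℂ R)) (iota t r B) := by
  rw [Qop_map]
  exact Commute.sum_left _ _ _ fun i _ => Commute.sum_left _ _ _ fun j _ =>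
    ((iota_commute hq _ _).mul_left (iota_commute hp _ _)).smul_left _

/-- Induction with `D` as accumulator of the factors already restored. As the list increases, `D`
commutes with everything in the factors still listed, and the remaining diagonal matrices commute
with everything in a factor `q < p`. So `trace_mul_swapOp` applies and puts `Q_{qp}` in front of
those matrices. -/
lemma trace_mul_transposedProd (κ : Fin n → K) (x : t.Idx → R)
    (Y : Matrix (Fin n → t.Idx) (Fin n → t.Idx) R) (l : List (Fin n)) (hl : l.Pairwise (· < ·))
    {D : Matrix (Fin n → t.Idx) (Fin n → t.Idx) R}
    (hD : ∀ p ∈ l, ∀ B, Commute D (iota t p B)) :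
    (D * (l.map fun p => iota t p (Matrix.diagonal x)).prod * transposedProd κ Y l).trace =
      (D * scaledProd (brauerFactor t κ) (fun _ => Matrix.diagonal x) l * Y).trace := by
  induction l generalizing D with
  | nil => simp [scaledProd, transposedProd]
  | cons p l ih =>
    rw [List.pairwise_cons] at hl
    set Z := transposedProd κ Y l with hZ
    have e : transposedProd κ Y (p :: l) = Z + κ p • ∑ q : Fin n with q < p, swapOp q p Z := rfl
    have hX : ∀ q, q < p → ∀ B, Commute
        ((p :: l).map fun p => iota t p (Matrix.diagonal x)).prod (iota t q B) := by
      intro q hq B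
      refine Commute.list_prod_left _ _ fun M hM => ?_
      obtain ⟨r, hr, rfl⟩ := List.mem_map.1 hM
      refine iota_commute (ne_of_gt ?_) _ _
      rcases List.mem_cons.1 hr with rfl | hr
      · exact hq
      · exact hq.trans (hl.1 r hr)
    have hQ : ∀ q ∈ Finset.univ.filter (· < p),
        (D * ((p :: l).map fun p => iota t p (Matrix.diagonal x)).prod * swapOp q p Z).trace =
        (D * (Qop t q p).map (algebraMap ℂ R) *
          ((p :: l).map fun p => iota t p (Matrix.diagonal x)).prod * Z).trace := by
      intro q hq
      have hq : q < p := by simpa using hq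
      exact trace_mul_swapOp hq.ne (hD p List.mem_cons_self) (hX q hq)
    -- The enlarged accumulator acquires only `Q_{qp}` with `q < p < r` and a matrix in factor `p`,
    -- none of which touches factor `r`.
    have hD' : ∀ r ∈ l, ∀ B, Commute
        (D * ((brauerFactor t κ p).map (algebraMap K R) * iota t p (Matrix.diagonal x)))
        (iota t r B) := by
      intro r hr B
      have hpr := hl.1 r hr
      refine (hD r (List.mem_cons_of_mem _ hr) B).mul_left
        (Commute.mul_left ?_ (iota_commute hpr.ne _ _))
      rw [brauerFactor_map]
      refine (Commute.one_left _).add_left (Commute.smul_left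
        (Commute.sum_left _ _ _ fun q hq => ?_) _)
      have hq : q < p := by simpa using hq
      exact Qop_map_commute (hq.trans hpr).ne hpr.ne B
    rw [e, scaledProd_cons, ← mul_assoc D, ← ih hl.2 hD', mul_add, Matrix.trace_add,
      mul_smul_comm, Matrix.trace_smul, Finset.mul_sum, Matrix.trace_sum,
      Finset.sum_congr rfl hQ, brauerFactor_map, ← Matrix.trace_sum, ← Matrix.trace_smul,
      ← Matrix.trace_add]
    congr 1
    simp only [List.map_cons, List.prod_cons, mul_add, add_mul, one_mul, mul_assoc,
      Finset.sum_mul, Finset.mul_sum, smul_mul_assoc, mul_smul_comm]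

end TraceIdentity

/-! ### The characteristic function of `Ψ_T(u)` -/

section CharFunPsi

variable {t : ClassicalType} {n : ℕ}

/-- The action of the group ring of `S_{2n}` over `ℂ(u)` in tensors. -/
def vecRepCu (t : ClassicalType) (n : ℕ) (R : Type*) [CommRing R] [Algebra ℂ R] :
    Cu ⊗[ℂ] GR2 n →ₐ[Cu] Module.End Cu (Vec t n (Cu ⊗[ℂ] R)) :=
  Algebra.TensorProduct.lift (Algebra.ofId _ _)
    (MonoidAlgebra.lift ℂ _ _ (vecRep t n Cu (Cu ⊗[ℂ] R))) fun _ _ => Algebra.commutes _ _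

variable {R : Type*} [CommRing R] [Algebra ℂ R]

lemma vecRepCu_tmul_gr (k : Cu) (τ : Equiv.Perm (Fin n ⊕ Fin n)) :
    vecRepCu t n R (k ⊗ₜ gr τ) = k • vecRep t n Cu (Cu ⊗[ℂ] R) τ := by
  change algebraMap Cu (Module.End Cu _) k *
    MonoidAlgebra.lift ℂ _ _ (vecRep t n Cu (Cu ⊗[ℂ] R)) (gr τ) = _
  rw [MonoidAlgebra.lift_single, one_smul, Algebra.smul_def]

lemma one_tmul_charFun_gr (x : t.Idx → R) (τ : Equiv.Perm (Fin n ⊕ Fin n)) :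
    (1 : Cu) ⊗ₜ[ℂ] charFun x n (gr τ) =
      pairing Cu (fun i => (1 : Cu) ⊗ₜ[ℂ] x i) n
        (vecRep t n Cu (Cu ⊗[ℂ] R) τ (formVec t n (Cu ⊗[ℂ] R))) := by
  let f : R →ₐ[ℂ] Cu ⊗[ℂ] R := Algebra.TensorProduct.includeRight
  have hgram : ∀ i j, f (gram t R i j) = gram t (Cu ⊗[ℂ] R) i j := by
    intro i j
    rw [gram, gram, apply_ite f, map_zero, AlgHom.commutes]
  change f (charFun x n (gr τ)) = pairing Cu (fun i => f (x i)) n _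
  rw [charFun_gr, map_sum, pairing_apply]
  refine Finset.sum_congr rfl fun c _ => ?_
  rw [map_mul, vecRep_apply, formVec, pairProd, pairProd, pairProd, pairProd, map_prod, map_prod]
  simp only [map_mul, hgram]

lemma baseChange_charFun (x : t.Idx → R) (z : Cu ⊗[ℂ] GR2 n) :
    (charFun x n).baseChange Cu z =
      pairing Cu (fun i => (1 : Cu) ⊗ₜ[ℂ] x i) n (vecRepCu t n R z (formVec t n _)) := by
  induction z using TensorProduct.induction_on with
  | zero => simp
  | add y z hy hz => rw [map_add, map_add, LinearMap.add_apply, map_add, hy, hz]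
  | tmul k y =>
    induction y using MonoidAlgebra.induction_linear with
    | zero => simp
    | add y z hy hz =>
      rw [TensorProduct.tmul_add, map_add, map_add, LinearMap.add_apply, map_add, hy, hz]
    | single τ a =>
      have h : (MonoidAlgebra.single τ a : GR2 n) = a • gr τ := by simp
      rw [h, TensorProduct.tmul_smul, TensorProduct.smul_tmul', vecRepCu_tmul_gr,
        LinearMap.smul_apply, map_smul, ← one_tmul_charFun_gr, LinearMap.baseChange_tmul,
        TensorProduct.smul_tmul', smul_eq_mul, mul_one]

/-- The leftmost factor of the product acts last, in agreement with the right fold in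
`transposedProd`. -/
lemma vecRepCu_prod_toVec (κ : Fin n → Cu)
    (Y : Matrix (Fin n → t.Idx) (Fin n → t.Idx) (Cu ⊗[ℂ] R)) (l : List (Fin n)) :
    vecRepCu t n R (l.map fun p => (1 + κ p ⊗ₜ[ℂ]
      (∑ q : Fin n with q < p, gr (Equiv.swap (Sum.inl q) (Sum.inr p))) : Cu ⊗[ℂ] GR2 n)).prod
        (toVec Y) = toVec (transposedProd κ Y l) := by
  induction l with
  | nil => rw [List.map_nil, List.prod_nil, map_one]; rfl
  | cons p l ih =>
    rw [List.map_cons, List.prod_cons, map_mul, Module.End.mul_apply, ih, map_add, map_one,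
      TensorProduct.tmul_sum, map_sum, LinearMap.add_apply, LinearMap.sum_apply]
    simp only [vecRepCu_tmul_gr, LinearMap.smul_apply, vecRep_swap_toVec]
    rw [← Finset.smul_sum, ← toVec_sum, ← toVec_smul]
    exact (toVec_add _ _).symm

lemma vecRepCu_groupRing_formVec (Φ : GroupRing (Fin n)) :
    vecRepCu t n R ((1 : Cu) ⊗ₜ[ℂ] ∑ σ : Equiv.Perm (Fin n), Φ.coeff σ • gr (embed σ))
      (formVec t n _) = toVec ((groupRingOp t Φ).map (algebraMap ℂ (Cu ⊗[ℂ] R))) := by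
  have h : (groupRingOp t Φ).map (algebraMap ℂ (Cu ⊗[ℂ] R)) =
      ∑ σ : Equiv.Perm (Fin n), algebraMap ℂ Cu (Φ.coeff σ) •
        (permOp t σ).map (algebraMap ℂ (Cu ⊗[ℂ] R)) := by
    ext a b
    simp only [groupRingOp, Matrix.map_apply, Matrix.sum_apply, map_sum, Matrix.smul_apply,
      smul_eq_mul, map_mul, algebraMap_smul]
    simp only [Algebra.smul_def]
  rw [h, toVec_sum, TensorProduct.tmul_sum, map_sum, LinearMap.sum_apply]
  refine Finset.sum_congr rfl fun σ _ => ?_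
  rw [TensorProduct.tmul_smul, TensorProduct.smul_tmul', vecRepCu_tmul_gr, LinearMap.smul_apply,
    vecRep_embed_formVec, toVec_smul, ← Algebra.algebraMap_eq_smul_one]

/-- `Φ` turns the invariant tensor into its operator on `n` factors, the transpositions turn that
into `transposedProd`, and the pairing takes the trace against the diagonal matrices. -/
lemma baseChange_charFun_Psi (x : t.Idx → R) {ν : YoungDiagram} (T : StandardTableau ν n)
    (Φ : GroupRing (Fin n)) :
    (charFun x n).baseChange Cu (Psi T Φ) =
      scaledTrace ((groupRingOp t Φ).map (algebraMap ℂ Cu))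
        (brauerFactor t fun p => (2 * RatFunc.X + (T.content p : Cu))⁻¹)
        fun _ => Matrix.diagonal fun i => (1 : Cu) ⊗ₜ[ℂ] x i := by
  have hmap : ((groupRingOp t Φ).map (algebraMap ℂ Cu)).map (algebraMap Cu (Cu ⊗[ℂ] R)) =
      (groupRingOp t Φ).map (algebraMap ℂ (Cu ⊗[ℂ] R)) := by
    ext a b
    rfl
  have h := trace_mul_transposedProd (t := t) (fun p => (2 * RatFunc.X + (T.content p : Cu))⁻¹)
    (fun i => (1 : Cu) ⊗ₜ[ℂ] x i) ((groupRingOp t Φ).map (algebraMap ℂ (Cu ⊗[ℂ] R)))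
    (List.finRange n) (List.pairwise_lt_finRange n) (D := 1) (fun _ _ _ => Commute.one_left _)
  rw [baseChange_charFun, Psi, map_mul, Module.End.mul_apply, vecRepCu_groupRing_formVec,
    List.ofFn_eq_map, vecRepCu_prod_toVec, pairing_toVec, scaledTrace,
    Matrix.trace_mul_comm _ (scaledProd _ _ _), hmap]
  rw [one_mul, one_mul, prod_iota_diagonal] at h
  exact h

end CharFunPsi

/-- The leading polynomial of `Z_ν(u)` is the value of the characteristic function
at `Ψ_T(u)`. -/
lemma isLeadingPolynomial_Zfun_iff (t : ClassicalType) {n : ℕ} {ν : YoungDiagram}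
    (T : StandardTableau ν n) (Φ : GroupRing (Fin n))
    (f : Cu ⊗[ℂ] MvPolynomial (Fin t.rank) ℂ) :
    t.IsLeadingPolynomial n (Zfun t T Φ) f ↔ f = (charFun t.coord n).baseChange Cu (Psi T Φ) := by
  have h : t.IsLeadingPolynomial n (Zfun t T Φ) ((charFun t.coord n).baseChange Cu (Psi T Φ)) := by
    rw [baseChange_charFun_Psi, Zfun_eq_scaledTrace]
    exact ClassicalType.isLeadingPolynomial_scaledTrace _ _ _
  exact ⟨fun hf => hf.unique t h, fun hf => hf ▸ h⟩

end Capelli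

end

/-! ### The orthogonal and symplectic cases of the proposition -/

open Capelli in
theorem proposition3p2 (m : ℕ) (ν : YoungDiagram) (T : StandardTableau ν (2 * m))
    {W : Type*} [NormedAddCommGroup W] [InnerProductSpace ℂ W]
    (ρ : Representation ℂ (Equiv.Perm (Fin (2 * m))) W) (w : W) (hw : IsYoungVector T ρ w) :
    (∀ N : ℕ, ν.colLen 0 ≤ N →
      ∃ ch : biSpace (hMinus (2 * m)) (hPlus (2 * m)) →ₗ[ℂ] Lam (ClassicalType.so N).rank,
        IsCharacteristicMap m _ _ _ ch ∧
        (∀ ch', IsCharacteristicMap m _ _ _ ch' → ch' = ch) ∧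
        ∀ f, (ClassicalType.so N).IsLeadingPolynomial (2 * m)
            (Zfun (ClassicalType.so N) T (matrixElement ρ w)) f ↔
          f = charImage ch (Psi T (matrixElement ρ w))) ∧
    (∀ M : ℕ, ν.colLen 0 ≤ 2 * M →
      ∃ ch : biSpace (hPlus (2 * m)) (hMinus (2 * m)) →ₗ[ℂ] Lam (ClassicalType.sp M).rank,
        IsCharacteristicMap m _ _ _ ch ∧
        (∀ ch', IsCharacteristicMap m _ _ _ ch' → ch' = ch) ∧
        ∀ f, (ClassicalType.sp M).IsLeadingPolynomial (2 * m)
            (Zfun (ClassicalType.sp M) T (matrixElement ρ w)) f ↔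
          f = charImage ch (Psi T (matrixElement ρ w))) := by
  refine ⟨fun N _ => ?_, fun M _ => ?_⟩
  · obtain ⟨ch, hch, himage⟩ := isTwistedPair_hMinus_hPlus.exists_isCharacteristicMap
      (charFun (ClassicalType.so N).coord (2 * m)) (charFun_sandwich_so N (2 * m))
      charFun_coord_gr_embed
    refine ⟨ch, hch, fun ch' hch' =>
      isTwistedPair_hMinus_hPlus.isCharacteristicMap_unique hch' hch, fun f => ?_⟩
    rw [himage, isLeadingPolynomial_Zfun_iff]
  · obtain ⟨ch, hch, himage⟩ := isTwistedPair_hPlus_hMinus.exists_isCharacteristicMap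
      (charFun (ClassicalType.sp M).coord (2 * m)) (charFun_sandwich_sp M (2 * m))
      charFun_coord_gr_embed
    refine ⟨ch, hch, fun ch' hch' =>
      isTwistedPair_hPlus_hMinus.isCharacteristicMap_unique hch' hch, fun f => ?_⟩
    rw [himage, isLeadingPolynomial_Zfun_iff]
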